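/- Let $\Sigma$ be a finite alphabet with at least two letters and $\mathsf{Vars}$ an infinite set of variables. A document is a word $d\in\Sigma^*$; a span of $d$ is an interval $[i,j\rangle$ with $0\le i\le j\le |d|$, and $d_{[i,j\rangle}$ is the subword of $d$ at that span. A mapping on $d$ is a function $m$ from a finite set $\mathrm{dom}(m)\subseteq\mathsf{Vars}$ to the spans of $d$, and a spanner $P$ assigns to every document $d$ a finite set $P(d)$ of mappings on $d$. Write $\mathsf{SVars}(P)$ for the set of variables assigned by at least one mapping of $P(d)$ for some $d$; $P$ is schema-based if $\mathrm{dom}(m)=\mathsf{SVars}(P)$ for all $d$ and all $m\in P(d)$. Regular spanners are those defined by sequential variable-set automata (finite automata with letter transitions and with transitions opening or closing a variable, each accepting run of which either reads no marker of a given variable or opens it exactly once and later closes it exactly once). Core spanners are the spanners obtained from regular spanners by iteratively applying projection $\pi_Y$ ($Y\subseteq\mathsf{SVars}(P)$), union, natural join, and string equality selection $(\zeta^=_Y P)(d)=\{m\in P(d)\mid d_{m(x)}=d_{m(y)}\text{ for all }x,y\in Y\cap\mathrm{dom}(m)\}$. Schema-based core spanners are those obtained in this way when only schema-based regular spanners are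 used, $\zeta^=_Y$ is applied to $P$ only if $Y\subseteq\mathsf{SVars}(P)$, and $P_1\cup P_2$ is formed only if $\mathsf{SVars}(P_1)=\mathsf{SVars}(P_2)$. For a domination relation $\le$ (a partial order on mappings), the skyline operator maps $P$ to the spanner $d\mapsto\{m\in P(d)\mid m\not\le m'\text{ for all }m'\in P(d)\setminus\{m\}\}$. Let $\eta_{\mathrm{spanInc}}$ be the skyline operator for the relation under which $m_2$ dominates $m_1$ iff $\mathrm{dom}(m_1)=\mathrm{dom}(m_2)$ and $m_1(x)$ is included in $m_2(x)$ for every $x\in\mathrm{dom}(m_1)$, and let $\eta_{\mathrm{varInc}}$ be the one for the relation under which $m_2$ dominates $m_1$ iff $\mathrm{dom}(m_1)\subseteq\mathrm{dom}(m_2)$ and $m_1(x)=m_2(x)$ for every $x\in\mathrm{dom}(m_1)$. Theorem. Core spanners are closed neither under $\eta_{\mathrm{spanInc}}$ nor under $\eta_{\mathrm{varInc}}$: 1. there is a schema-based core spanner $P$ such that $\eta_{\mathrm{spanInc}}P$ is not a core spanner; 2. there is a core spanner $P$ such that $\eta_{\mathrm{varInc}}P$ is not a core spanner. -/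

import Mathlib

namespace DocSpanner

/-! ### Spans, mappings, spanners -/

/-- A span `[lo, hi⟩` with `0 ≤ lo ≤ hi`. -/
@[ext]
structure Span where
  lo : ℕ
  hi : ℕ
  le : lo ≤ hi

/-- Inclusion of spans: `s` is included in `t`. -/
def Span.Included (s t : Span) : Prop := t.lo ≤ s.lo ∧ s.hi ≤ t.hi

/-- The contiguous subword of the document `d` at the span `s`. -/
def content {α : Type*} (d : List α) (s : Span) : List α :=
  (d.drop s.lo).take (s.hi - s.lo)

/-- A mapping: a function from a finite set of variables to spans, written as a partial function
with finite domain. -/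
@[ext]
structure Mapping (Var : Type*) where
  toFun : Var → Option Span
  finite_dom : {x | ∃ s, toFun x = some s}.Finite

namespace Mapping

variable {Var : Type*}

/-- The set of variables assigned by a mapping. -/
def dom (m : Mapping Var) : Set Var := {x | ∃ s, m.toFun x = some s}

/-- All spans of the mapping are spans of a document of length `n`. -/
def Over (m : Mapping Var) (n : ℕ) : Prop := ∀ x s, m.toFun x = some s → s.hi ≤ n

/-- Two mappings are compatible if they agree on the variables that both of them assign. -/
def Compatible (m m' : Mapping Var) : Prop :=
  ∀ x ∈ m.dom ∩ m'.dom, m.toFun x = m'.toFun x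

open Classical in
/-- Restriction of a mapping to a set of variables. -/
noncomputable def restrict (m : Mapping Var) (Y : Set Var) : Mapping Var where
  toFun x := if x ∈ Y then m.toFun x else none
  finite_dom := m.finite_dom.subset (by
    rintro x ⟨s, hs⟩
    by_cases hx : x ∈ Y
    · exact ⟨s, by simpa [hx] using hs⟩
    · simp [hx] at hs)

theorem restrict_over {m : Mapping Var} {n : ℕ} (h : m.Over n) (Y : Set Var) :
    (m.restrict Y).Over n := by
  intro x s hs
  by_cases hx : x ∈ Y
  · exact h x s (by simpa [restrict, hx] using hs)
  · simp [restrict, hx] at hs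

theorem finite_spans (n : ℕ) : {s : Span | s.hi ≤ n}.Finite := by
  refine Set.Finite.of_finite_image (f := fun s : Span => (s.lo, s.hi)) ?_ ?_
  · refine ((Set.finite_Iic n).prod (Set.finite_Iic n)).subset ?_
    rintro _ ⟨s, hs, rfl⟩
    exact ⟨s.le.trans hs, hs⟩
  · intro s _ t _ h
    simp only [Prod.mk.injEq] at h
    exact Span.ext h.1 h.2

/-- There are finitely many mappings over a given document and a given finite set of variables. -/
theorem finite_over {V : Set Var} (hV : V.Finite) (n : ℕ) :
    {m : Mapping Var | m.dom ⊆ V ∧ m.Over n}.Finite := by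
  have : Finite V := hV
  refine Set.Finite.of_finite_image (f := fun m : Mapping Var => fun x : V => m.toFun x) ?_ ?_
  · have hfin : (insert none (some '' {s : Span | s.hi ≤ n})).Finite :=
      ((finite_spans n).image _).insert _
    refine (Set.Finite.pi (fun _ : V => hfin)).subset ?_
    rintro _ ⟨m, hm, rfl⟩ x _
    cases h : m.toFun x with
    | none => exact Or.inl h
    | some s => exact Or.inr ⟨s, hm.2 _ _ h, h.symm⟩
  · intro m hm m' hm' h
    ext1
    funext x
    by_cases hx : x ∈ V
    · exact congrFun h ⟨x, hx⟩
    · have h1 : m.toFun x = none := by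
        rw [Option.eq_none_iff_forall_ne_some]
        exact fun s hs => hx (hm.1 ⟨s, hs⟩)
      have h2 : m'.toFun x = none := by
        rw [Option.eq_none_iff_forall_ne_some]
        exact fun s hs => hx (hm'.1 ⟨s, hs⟩)
      rw [h1, h2]

end Mapping

/-- A (schemaless) spanner: a function from documents `d` to finite sets of mappings whose spans
are spans of `d`. -/
@[ext]
structure Spanner (α Var : Type*) where
  toFun : List α → Set (Mapping Var)
  finite : ∀ d, (toFun d).Finite
  isOver : ∀ d, ∀ m ∈ toFun d, m.Over d.length

namespace Spanner

variable {α Var : Type*}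

/-- The variables assigned by at least one mapping captured on some document. -/
def svars (P : Spanner α Var) : Set Var := {x | ∃ d, ∃ m ∈ P.toFun d, x ∈ m.dom}

/-- All captured mappings assign exactly the variables of `svars`. -/
def IsSchemaBased (P : Spanner α Var) : Prop := ∀ d, ∀ m ∈ P.toFun d, m.dom = P.svars

/-! ### Spanner algebra -/

/-- The projection `π_Y`. -/
noncomputable def proj (Y : Set Var) (P : Spanner α Var) : Spanner α Var where
  toFun d := (fun m => m.restrict Y) '' P.toFun d
  finite d := (P.finite d).image _
  isOver := by
    rintro d _ ⟨m, hm, rfl⟩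
    exact Mapping.restrict_over (P.isOver d m hm) Y

/-- The union of two spanners. -/
def union (P₁ P₂ : Spanner α Var) : Spanner α Var where
  toFun d := P₁.toFun d ∪ P₂.toFun d
  finite d := (P₁.finite d).union (P₂.finite d)
  isOver d m hm := hm.elim (P₁.isOver d m) (P₂.isOver d m)

/-- The set of unions of compatible pairs of mappings from two sets. -/
def joinSet (S₁ S₂ : Set (Mapping Var)) : Set (Mapping Var) :=
  {m | ∃ m₁ ∈ S₁, ∃ m₂ ∈ S₂, m₁.Compatible m ∧ m₂.Compatible m ∧ m₁.dom ∪ m₂.dom = m.dom}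

theorem joinSet_over {S₁ S₂ : Set (Mapping Var)} {n : ℕ} (h₁ : ∀ m ∈ S₁, m.Over n)
    (h₂ : ∀ m ∈ S₂, m.Over n) : ∀ m ∈ joinSet S₁ S₂, m.Over n := by
  rintro m ⟨m₁, hm₁, m₂, hm₂, c₁, c₂, hd⟩ x s hs
  have hx : x ∈ m.dom := ⟨s, hs⟩
  have hx' := hx
  rw [← hd] at hx'
  rcases hx' with h | h
  · exact h₁ _ hm₁ x s ((c₁ x ⟨h, hx⟩).trans hs)
  · exact h₂ _ hm₂ x s ((c₂ x ⟨h, hx⟩).trans hs)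

theorem joinSet_finite {S₁ S₂ : Set (Mapping Var)} {n : ℕ} (f₁ : S₁.Finite) (f₂ : S₂.Finite)
    (h₁ : ∀ m ∈ S₁, m.Over n) (h₂ : ∀ m ∈ S₂, m.Over n) : (joinSet S₁ S₂).Finite := by
  have hV : ((⋃ m ∈ S₁, m.dom) ∪ ⋃ m ∈ S₂, m.dom).Finite :=
    (f₁.biUnion fun m _ => m.finite_dom).union (f₂.biUnion fun m _ => m.finite_dom)
  refine (Mapping.finite_over hV n).subset fun m hm => ⟨?_, joinSet_over h₁ h₂ m hm⟩
  obtain ⟨m₁, hm₁, m₂, hm₂, _, _, hd⟩ := hm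
  rw [← hd]
  exact Set.union_subset_union (Set.subset_biUnion_of_mem (u := fun m => Mapping.dom m) hm₁)
    (Set.subset_biUnion_of_mem (u := fun m => Mapping.dom m) hm₂)

/-- The natural join of two spanners. -/
def join (P₁ P₂ : Spanner α Var) : Spanner α Var where
  toFun d := joinSet (P₁.toFun d) (P₂.toFun d)
  finite d := joinSet_finite (P₁.finite d) (P₂.finite d) (P₁.isOver d) (P₂.isOver d)
  isOver d := joinSet_over (P₁.isOver d) (P₂.isOver d)

/-- The string equality selection `ζ^=_Y`: keep the mappings such that any two variables of `Y`
that are both assigned are assigned to spans containing the same word. The selection for two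
variables `x`, `y` is the case `Y = {x, y}`, and the selection for a finite family of sets is
the iteration of this operator. -/
def eqSel (Y : Set Var) (P : Spanner α Var) : Spanner α Var where
  toFun d := {m ∈ P.toFun d | ∀ x ∈ Y, ∀ y ∈ Y, ∀ s t,
    m.toFun x = some s → m.toFun y = some t → content d s = content d t}
  finite d := (P.finite d).subset fun _ h => h.1
  isOver d m h := P.isOver d m h.1

end Spanner

/-! ### Variable-set automata and regular spanners -/

/-- Transition labels: a letter, an opening marker `⊢x` or a closing marker `x⊣`. -/
inductive Label (α Var : Type*) where
  | letter (a : α)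
  | opening (x : Var)
  | closing (x : Var)

/-- The restriction of a sequence of labels to the letters. -/
def letters {α Var : Type*} : List (Label α Var) → List α
  | [] => []
  | .letter a :: w => a :: letters w
  | .opening _ :: w => letters w
  | .closing _ :: w => letters w

/-- The markers of `x` do not occur in `w`. -/
def Unread {α Var : Type*} (w : List (Label α Var)) (x : Var) : Prop :=
  Label.opening x ∉ w ∧ Label.closing x ∉ w

/-- The markers of `x` occur exactly once each in `w`, the opening marker first: `u`, `v`, `t` are
the parts of `w` before the opening marker, between the two markers, and after the closing
marker. -/
def ReadAs {α Var : Type*} (w : List (Label α Var)) (x : Var) (u v t : List (Label α Var)) :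
    Prop :=
  w = u ++ Label.opening x :: (v ++ Label.closing x :: t) ∧
    Unread u x ∧ Unread v x ∧ Unread t x

/-- Validity of the label sequence of a run. -/
def ValidLabels {α Var : Type*} (w : List (Label α Var)) : Prop :=
  ∀ x, Unread w x ∨ ∃ u v t, ReadAs w x u v t

/-- `m` is the mapping defined by a run with label sequence `w`: variables whose markers are not
read are unassigned, the others are assigned the span between the positions in the document at
which their markers are read. -/
def Defines {α Var : Type*} (w : List (Label α Var)) (m : Mapping Var) : Prop :=
  ∀ x, (Unread w x ∧ m.toFun x = none) ∨ ∃ u v t, ReadAs w x u v t ∧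
    m.toFun x = some ⟨(letters u).length, (letters u).length + (letters v).length,
      Nat.le_add_right _ _⟩

/-- A variable-set automaton with finite state set over the finite set `vars` of variables. -/
structure VA (α Var : Type*) where
  State : Type
  finite_state : Finite State
  start : State
  accept : Set State
  vars : Set Var
  finite_vars : vars.Finite
  step : Set (State × Label α Var × State)
  opening_mem : ∀ q x q', (q, Label.opening x, q') ∈ step → x ∈ vars
  closing_mem : ∀ q x q', (q, Label.closing x, q') ∈ step → x ∈ vars

namespace VA

variable {α Var : Type*}

/-- `A.Run q w q'`: there is a run from `q` to `q'` with label sequence `w`. -/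
inductive Run (A : VA α Var) : A.State → List (Label α Var) → A.State → Prop
  | nil (q : A.State) : Run A q [] q
  | cons {q q' q'' : A.State} {l : Label α Var} {w : List (Label α Var)} :
      (q, l, q') ∈ A.step → Run A q' w q'' → Run A q (l :: w) q''

/-- `w` is the label sequence of an accepting run. -/
def Accepts (A : VA α Var) (w : List (Label α Var)) : Prop := ∃ q ∈ A.accept, A.Run A.start w q

/-- All accepting runs are valid. -/
def IsSequential (A : VA α Var) : Prop := ∀ w, A.Accepts w → ValidLabels w

theorem Run.mem_vars {A : VA α Var} {q q' : A.State} {w : List (Label α Var)}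
    (h : A.Run q w q') {x : Var} (hx : Label.opening x ∈ w) : x ∈ A.vars := by
  induction h with
  | nil q => simp at hx
  | cons hs _ ih =>
    rcases List.mem_cons.1 hx with rfl | hx
    · exact A.opening_mem _ _ _ hs
    · exact ih hx

theorem letters_append (u v : List (Label α Var)) : letters (u ++ v) = letters u ++ letters v := by
  induction u with
  | nil => rfl
  | cons l u ih => cases l <;> simp [letters, ih]

/-- The spanner of an automaton: on `d`, the mappings defined by its accepting runs on `d`. -/
def spanner (A : VA α Var) : Spanner α Var where
  toFun d := {m | ∃ w, A.Accepts w ∧ letters w = d ∧ Defines w m}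
  isOver := by
    rintro d m ⟨w, -, rfl, hm⟩ x s hs
    rcases hm x with ⟨_, h⟩ | ⟨u, v, t, ⟨rfl, -⟩, h⟩
    · simp [h] at hs
    · rw [h] at hs
      cases hs
      simp only [letters_append, letters, List.length_append]
      omega
  finite d := by
    refine (Mapping.finite_over A.finite_vars d.length).subset ?_
    rintro m ⟨w, ⟨q, -, hr⟩, rfl, hm⟩
    constructor
    · rintro x ⟨s, hs⟩
      rcases hm x with ⟨_, h⟩ | ⟨u, v, t, ⟨rfl, -⟩, -⟩
      · simp [h] at hs
      · exact hr.mem_vars (x := x) (by simp)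
    · intro x s hs
      rcases hm x with ⟨_, h⟩ | ⟨u, v, t, ⟨rfl, -⟩, h⟩
      · simp [h] at hs
      · rw [h] at hs
        cases hs
        simp only [letters_append, letters, List.length_append]
        omega

end VA

namespace Spanner

variable {α Var : Type*}

/-- Regular spanners: those defined by sequential variable-set automata. -/
def IsRegular (P : Spanner α Var) : Prop := ∃ A : VA α Var, A.IsSequential ∧ A.spanner = P

/-! ### Core spanners -/

/-- Core spanners: obtained from regular spanners by projection, union, join and string equality
selection. -/
inductive IsCore : Spanner α Var → Prop
  | regular {P : Spanner α Var} : P.IsRegular → IsCore P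
  | proj {P : Spanner α Var} (Y : Set Var) : Y ⊆ P.svars → IsCore P → IsCore (P.proj Y)
  | union {P₁ P₂ : Spanner α Var} : IsCore P₁ → IsCore P₂ → IsCore (P₁.union P₂)
  | join {P₁ P₂ : Spanner α Var} : IsCore P₁ → IsCore P₂ → IsCore (P₁.join P₂)
  | eqSel {P : Spanner α Var} (Y : Set Var) : IsCore P → IsCore (P.eqSel Y)

/-- Schema-based core spanners: the regular spanners used are schema-based, string equality
selections range over variables of their argument, and unions are formed only of spanners with
the same set of variables. -/
inductive IsSchemaBasedCore : Spanner α Var → Prop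
  | regular {P : Spanner α Var} : P.IsRegular → P.IsSchemaBased → IsSchemaBasedCore P
  | proj {P : Spanner α Var} (Y : Set Var) :
      Y ⊆ P.svars → IsSchemaBasedCore P → IsSchemaBasedCore (P.proj Y)
  | union {P₁ P₂ : Spanner α Var} : P₁.svars = P₂.svars →
      IsSchemaBasedCore P₁ → IsSchemaBasedCore P₂ → IsSchemaBasedCore (P₁.union P₂)
  | join {P₁ P₂ : Spanner α Var} :
      IsSchemaBasedCore P₁ → IsSchemaBasedCore P₂ → IsSchemaBasedCore (P₁.join P₂)
  | eqSel {P : Spanner α Var} (Y : Set Var) :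
      Y ⊆ P.svars → IsSchemaBasedCore P → IsSchemaBasedCore (P.eqSel Y)

end Spanner

/-! ### Domination and the skyline operator -/

/-- A domination rule: for every document a domination relation, that is, a (non-strict) partial
order on mappings. `rel d m₁ m₂` says that `m₂` dominates `m₁` on `d`. -/
structure DominationRule (α Var : Type*) where
  rel : List α → Mapping Var → Mapping Var → Prop
  refl : ∀ d m, rel d m m
  trans : ∀ d m₁ m₂ m₃, rel d m₁ m₂ → rel d m₂ m₃ → rel d m₁ m₃
  antisymm : ∀ d m₁ m₂, rel d m₁ m₂ → rel d m₂ m₁ → m₁ = m₂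

/-- The skyline operator: keep the mappings not dominated by another captured mapping. -/
def skyline {α Var : Type*} (D : DominationRule α Var) (P : Spanner α Var) : Spanner α Var where
  toFun d := {m ∈ P.toFun d | ∀ m' ∈ P.toFun d \ {m}, ¬ D.rel d m m'}
  finite d := (P.finite d).subset fun _ h => h.1
  isOver d m h := P.isOver d m h.1

/-- The variable inclusion rule: `m₂` assigns every variable that `m₁` assigns, to the same
span. -/
def varInc (α Var : Type*) : DominationRule α Var where
  rel _ m₁ m₂ := ∀ x s, m₁.toFun x = some s → m₂.toFun x = some s
  refl _ _ _ _ h := h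
  trans _ _ _ _ h h' x s hs := h' x s (h x s hs)
  antisymm _ _ _ h h' := by
    ext x s
    exact ⟨h x s, h' x s⟩

/-- The span inclusion rule: `m₁` and `m₂` assign the same variables, and every span assigned by
`m₁` is included in the span assigned by `m₂` to the same variable. -/
def spanInc (α Var : Type*) : DominationRule α Var where
  rel _ m₁ m₂ := m₁.dom = m₂.dom ∧
    ∀ x s t, m₁.toFun x = some s → m₂.toFun x = some t → s.Included t
  refl _ _ := by
    refine ⟨rfl, fun x s t hs ht => ?_⟩
    cases hs.symm.trans ht
    exact ⟨le_rfl, le_rfl⟩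
  trans _ m₁ m₂ m₃ h h' := by
    refine ⟨h.1.trans h'.1, fun x s t hs ht => ?_⟩
    obtain ⟨r, hr⟩ : x ∈ m₂.dom := h.1 ▸ (⟨s, hs⟩ : x ∈ m₁.dom)
    have a := h.2 x s r hs hr
    have b := h'.2 x r t hr ht
    exact ⟨b.1.trans a.1, a.2.trans b.2⟩
  antisymm _ m₁ m₂ h h' := by
    have key : ∀ x s t, m₁.toFun x = some s → m₂.toFun x = some t → s = t := by
      intro x s t hs ht
      have a := h.2 x s t hs ht
      have b := h'.2 x t s ht hs
      exact Span.ext (le_antisymm b.1 a.1) (le_antisymm a.2 b.2)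
    ext x s
    constructor
    · intro hs
      obtain ⟨t, ht⟩ : x ∈ m₂.dom := h.1 ▸ (⟨s, hs⟩ : x ∈ m₁.dom)
      rw [key x s t hs ht]
      exact ht
    · intro hs
      obtain ⟨t, ht⟩ : x ∈ m₁.dom := h'.1 ▸ (⟨s, hs⟩ : x ∈ m₂.dom)
      rw [← key x t s ht hs]
      exact ht

end DocSpanner

/-!
The inexpressibility argument is a pumping property that is stable under all operations of the
spanner algebra, so that no normal form for core spanners is needed. Fix letters `a ≠ b` and
consider documents that are concatenations of blocks `b aⁿ b` with pairwise distinct `n`. A spanner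
is `Pumpable` if, for each mapping captured on such a document, all but a bounded number of the
blocks with large `n` can be lengthened by any multiple of a fixed period, the mapping (with its
spans moved accordingly) still being captured on the new document.

* For regular spanners (`VA.pumpable`), the excluded blocks are those with an end point of a span in
  their interior. In any other block the run reads `aⁿ` without markers, and it can be pumped.
* Projection, union and join are immediate.
* For string equality selection (`Pumpable.eqSel`), the blocks with an end point in their interior
  are excluded as well. A span that meets the interior of a remaining block contains the whole
  block, which occurs only once in the document. Such a span has the contents of no other span
  (`eq_of_content_eq`), and all other spans keep their contents.

So all core spanners are pumpable (`Spanner.IsCore.pumpable`). On the other side, the core spanner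
`repeatedBlock` captures `z ↦ [0, |d|⟩` if some word `b aⁿ b` with `n ≥ 1` has two disjoint
occurrences in `d`, and nothing otherwise. Its union with a spanner that always captures one dominated mapping `m₀`
(`z ↦ [0, 0⟩` for span inclusion, the empty mapping for variable inclusion) has a skyline that
contains `m₀` exactly if no block is repeated. This skyline is not pumpable
(`not_isCore_skyline_union`): if the numbers `n` form an arithmetic progression whose difference is
the period, then pumping a block makes it equal to the next one.
-/

namespace DocSpanner

variable {α Var : Type*}

open VA (letters_append)

/-! ### Label sequences -/

@[simp]
theorem letters_map_letter (u : List α) : letters (u.map (Label.letter (Var := Var))) = u := by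
  induction u with
  | nil => rfl
  | cons c u ih => simp [letters, ih]

theorem exists_of_letters_eq_append_cons {w : List (Label α Var)} {u t : List α} {c : α}
    (h : letters w = u ++ c :: t) :
    ∃ w₁ w₂, w = w₁ ++ Label.letter c :: w₂ ∧ letters w₁ = u ∧ letters w₂ = t := by
  induction w generalizing u with
  | nil => simp [letters] at h
  | cons l w ih =>
    cases l with
    | letter e =>
      cases u with
      | nil =>
        simp only [letters, List.nil_append, List.cons.injEq] at h
        exact ⟨[], w, by simp [h.1], rfl, h.2⟩
      | cons e' u =>
        simp only [letters, List.cons_append, List.cons.injEq] at h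
        obtain ⟨w₁, w₂, rfl, h₁, h₂⟩ := ih h.2
        exact ⟨.letter e :: w₁, w₂, rfl, by simp [letters, h.1, h₁], h₂⟩
    | opening x =>
      obtain ⟨w₁, w₂, rfl, h₁, h₂⟩ := ih (u := u) (by simpa [letters] using h)
      exact ⟨.opening x :: w₁, w₂, rfl, by simpa [letters] using h₁, h₂⟩
    | closing x =>
      obtain ⟨w₁, w₂, rfl, h₁, h₂⟩ := ih (u := u) (by simpa [letters] using h)
      exact ⟨.closing x :: w₁, w₂, rfl, by simpa [letters] using h₁, h₂⟩

theorem eq_map_letter_letters {w : List (Label α Var)}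
    (h : ∀ x, Label.opening x ∉ w ∧ Label.closing x ∉ w) :
    w = (letters w).map Label.letter := by
  induction w with
  | nil => rfl
  | cons l w ih =>
    have ih := ih fun x => ⟨fun hx => (h x).1 (by simp [hx]), fun hx => (h x).2 (by simp [hx])⟩
    cases l with
    | letter e => simpa [letters] using ih
    | opening x => exact absurd (by simp) (h x).1
    | closing x => exact absurd (by simp) (h x).2

theorem ReadAs.opening_unique {w u v t u' r : List (Label α Var)} {x : Var} (h : ReadAs w x u v t)
    (h' : w = u' ++ Label.opening x :: r) : u = u' := by
  obtain ⟨rfl, hu, hv, ht⟩ := h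
  exact ((List.append_cons_inj_of_notMem hu.1 (by simp [hv.1, ht.1])).1 h').1

theorem ReadAs.closing_unique {w u v t u' r : List (Label α Var)} {x : Var} (h : ReadAs w x u v t)
    (h' : w = u' ++ Label.closing x :: r) : u ++ Label.opening x :: v = u' := by
  obtain ⟨rfl, hu, hv, ht⟩ := h
  refine ((List.append_cons_inj_of_notMem (x₁ := u ++ Label.opening x :: v) ?_ ht.2).1
    (by simpa using h')).1
  simp [hu.2, hv.2]

theorem ReadAs.unique {w u v t u' v' t' : List (Label α Var)} {x : Var} (h : ReadAs w x u v t)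
    (h' : ReadAs w x u' v' t') : u = u' ∧ v = v' := by
  obtain rfl := h.opening_unique h'.1
  simpa using h.closing_unique (u' := u ++ Label.opening x :: v') (r := t') (by simp [h'.1])

theorem Unread.not_readAs {w u v t : List (Label α Var)} {x : Var} (h : Unread w x) :
    ¬ ReadAs w x u v t := by
  rintro ⟨rfl, -⟩
  exact h.1 (by simp)

theorem Defines.unique {w : List (Label α Var)} {m m' : Mapping Var} (h : Defines w m)
    (h' : Defines w m') : m = m' := by
  ext1
  funext x
  rcases h x with ⟨hx, e⟩ | ⟨u, v, t, hx, e⟩ <;> rcases h' x with ⟨hx', e'⟩ | ⟨u', v', t', hx', e'⟩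
  · rw [e, e']
  · exact absurd hx' hx.not_readAs
  · exact absurd hx hx'.not_readAs
  · obtain ⟨rfl, rfl⟩ := hx.unique hx'
    rw [e, e']

theorem Defines.toFun_eq {w u v t : List (Label α Var)} {m : Mapping Var} {x : Var}
    (h : Defines w m) (hx : ReadAs w x u v t) :
    m.toFun x = some ⟨(letters u).length, (letters u).length + (letters v).length,
      Nat.le_add_right _ _⟩ := by
  rcases h x with ⟨hx', -⟩ | ⟨u', v', t', hx', e⟩
  · exact absurd hx hx'.not_readAs
  · obtain ⟨rfl, rfl⟩ := hx.unique hx'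
    exact e

theorem Defines.toFun_eq_none {w : List (Label α Var)} {m : Mapping Var} {x : Var}
    (h : Defines w m) (hx : Unread w x) : m.toFun x = none := by
  rcases h x with ⟨-, e⟩ | ⟨u', v', t', hx', -⟩
  · exact e
  · exact absurd hx' hx.not_readAs

theorem ValidLabels.exists_defines {w : List (Label α Var)} (h : ValidLabels w) :
    ∃ m : Mapping Var, Defines w m := by
  have key : ∀ x, ∃ o : Option Span, (Unread w x ∧ o = none) ∨ ∃ u v t, ReadAs w x u v t ∧
      o = some ⟨(letters u).length, (letters u).length + (letters v).length,
        Nat.le_add_right _ _⟩ := by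
    intro x
    rcases h x with hx | ⟨u, v, t, hx⟩
    · exact ⟨_, Or.inl ⟨hx, rfl⟩⟩
    · exact ⟨_, Or.inr ⟨u, v, t, hx, rfl⟩⟩
  choose f hf using key
  refine ⟨⟨f, ?_⟩, hf⟩
  have hfin : (Label.opening ⁻¹' {l : Label α Var | l ∈ w} : Set Var).Finite :=
    (List.finite_toSet w).preimage fun x _ y _ h => Label.opening.inj h
  refine hfin.subset ?_
  rintro x ⟨s, hs⟩
  rcases hf x with ⟨-, e⟩ | ⟨u, v, t, ⟨rfl, -⟩, -⟩
  · simp [e] at hs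
  · simp

/-! ### Shifting spans and mappings -/

/-- The position to which `i` moves when `c` letters are inserted somewhere after position `s` and
before the next position of interest. -/
def shiftPos (s c i : ℕ) : ℕ := if i ≤ s then i else i + c

theorem shiftPos_mono (s c : ℕ) : Monotone (shiftPos s c) := by
  intro i j h
  unfold shiftPos
  split_ifs <;> omega

theorem shiftPos_of_le {s i : ℕ} (c : ℕ) (h : i ≤ s) : shiftPos s c i = i := if_pos h

theorem shiftPos_of_lt {s i : ℕ} (c : ℕ) (h : s < i) : shiftPos s c i = i + c :=
  if_neg (by omega)

/-- The span whose end points are those of `t`, moved by `shiftPos s c`. -/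
def Span.shift (s c : ℕ) (t : Span) : Span :=
  ⟨shiftPos s c t.lo, shiftPos s c t.hi, shiftPos_mono s c t.le⟩

/-- The mapping that assigns the spans of `m`, moved by `Span.shift s c`. -/
def Mapping.shift (s c : ℕ) (m : Mapping Var) : Mapping Var where
  toFun x := (m.toFun x).map (Span.shift s c)
  finite_dom := m.finite_dom.subset (by
    rintro x ⟨t, ht⟩
    obtain ⟨r, hr, -⟩ := Option.map_eq_some_iff.1 ht
    exact ⟨r, hr⟩)

theorem Mapping.dom_shift (s c : ℕ) (m : Mapping Var) : (m.shift s c).dom = m.dom := by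
  ext x
  simp [Mapping.dom, Mapping.shift]

theorem Mapping.restrict_shift (s c : ℕ) (m : Mapping Var) (Y : Set Var) :
    (m.restrict Y).shift s c = (m.shift s c).restrict Y := by
  ext1
  funext x
  by_cases hx : x ∈ Y <;> simp [Mapping.shift, Mapping.restrict, hx]

theorem Mapping.Compatible.shift {m m' : Mapping Var} (h : m.Compatible m') (s c : ℕ) :
    (m.shift s c).Compatible (m'.shift s c) := by
  intro x hx
  rw [Mapping.dom_shift, Mapping.dom_shift] at hx
  simp [Mapping.shift, h x hx]

/-- An occurrence of a marker in `w₁ ++ D ++ w₂`, where `D` consists of letters, lies in `w₁` or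
in `w₂`. -/
theorem append_map_letter_eq_append_cons {w₁ w₂ u r : List (Label α Var)} {D : List α}
    {l : Label α Var} (hl : ∀ c, l ≠ Label.letter c)
    (h : w₁ ++ (D.map Label.letter ++ w₂) = u ++ l :: r) :
    (∃ r₁, w₁ = u ++ l :: r₁ ∧ r = r₁ ++ (D.map Label.letter ++ w₂)) ∨
      ∃ u₂, u = w₁ ++ (D.map Label.letter ++ u₂) ∧ w₂ = u₂ ++ l :: r := by
  rcases List.append_eq_append_iff.1 h with ⟨e, rfl, he⟩ | ⟨e, rfl, he⟩
  · right
    rcases List.append_eq_append_iff.1 he with ⟨f, rfl, hf⟩ | ⟨f, hD, hf⟩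
    · exact ⟨f, rfl, hf⟩
    · cases f with
      | nil => exact ⟨[], by simpa using hD.symm, by simpa using hf.symm⟩
      | cons l' f =>
        simp only [List.cons_append, List.cons.injEq] at hf
        have : l ∈ D.map Label.letter := by rw [hD, hf.1]; simp
        obtain ⟨c, -, hc⟩ := List.mem_map.1 this
        exact absurd hc.symm (hl c)
  · cases e with
    | nil =>
      right
      cases D with
      | nil => exact ⟨[], by simp, by simpa using he.symm⟩
      | cons c D =>
        simp only [List.map_cons, List.cons_append, List.nil_append, List.cons.injEq] at he
        exact absurd he.1 (hl c)
    | cons l' e =>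
      simp only [List.cons_append, List.cons.injEq] at he
      exact Or.inl ⟨e, by rw [he.1], he.2⟩

theorem unread_append_map_letter {w₁ w₂ : List (Label α Var)} {D : List α} {x : Var} :
    Unread (w₁ ++ (D.map Label.letter ++ w₂)) x ↔ Unread w₁ x ∧ Unread w₂ x := by
  simp [Unread]
  tauto

/-- Replacing a nonempty block of letters that no marker interrupts by a longer one shifts the
mapping defined by a label sequence. -/
theorem Defines.shift {w₁ w₂ : List (Label α Var)} {D D' : List α} {c : ℕ} {m : Mapping Var}
    (h : Defines (w₁ ++ (D.map Label.letter ++ w₂)) m) (hD : 0 < D.length)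
    (hc : D'.length = D.length + c) :
    Defines (w₁ ++ (D'.map Label.letter ++ w₂)) (m.shift (letters w₁).length c) := by
  intro x
  rcases h x with ⟨hx, e⟩ | ⟨u, v, t, ⟨hw, hu, hv, ht⟩, e⟩
  · left
    rw [unread_append_map_letter] at hx ⊢
    exact ⟨hx, by simp [Mapping.shift, e]⟩
  right
  rcases append_map_letter_eq_append_cons (by simp) hw with ⟨r₁, rfl, hr⟩ | ⟨u₂, rfl, rfl⟩
  · rcases append_map_letter_eq_append_cons (by simp) hr.symm with ⟨r₂, rfl, rfl⟩ | ⟨v₂, rfl, rfl⟩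
    · refine ⟨u, v, r₂ ++ (D'.map Label.letter ++ w₂), ⟨by simp, hu, hv, ?_⟩, ?_⟩
      · rw [unread_append_map_letter] at ht ⊢
        exact ht
      · simp only [Mapping.shift, e, Option.map_some, Span.shift, Option.some.injEq]
        ext
        · exact shiftPos_of_le _ (by simp [letters_append])
        · exact shiftPos_of_le _ (by simp [letters_append, letters])
    · refine ⟨u, r₁ ++ (D'.map Label.letter ++ v₂), t, ⟨by simp, hu, ?_, ht⟩, ?_⟩
      · rw [unread_append_map_letter] at hv ⊢
        exact hv
      · simp only [Mapping.shift, e, Option.map_some, Span.shift, Option.some.injEq]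
        ext
        · exact shiftPos_of_le _ (by simp [letters_append])
        · simp only
          rw [shiftPos_of_lt]
          · simp only [letters_append, letters_map_letter, List.length_append, hc]
            omega
          · simp only [letters_append, letters_map_letter, List.length_append, letters]
            omega
  · refine ⟨w₁ ++ (D'.map Label.letter ++ u₂), v, t, ⟨by simp, ?_, hv, ht⟩, ?_⟩
    · rw [unread_append_map_letter] at hu ⊢
      exact hu
    · simp only [Mapping.shift, e, Option.map_some, Span.shift, Option.some.injEq]
      ext
      all_goals
        simp only
        rw [shiftPos_of_lt]
        · simp only [letters_append, letters_map_letter, List.length_append, hc]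
          omega
        · simp only [letters_append, letters_map_letter, List.length_append]
          omega

/-! ### Pumping runs -/

namespace VA

theorem run_append {A : VA α Var} {u v : List (Label α Var)} {q q' : A.State} :
    A.Run q (u ++ v) q' ↔ ∃ r, A.Run q u r ∧ A.Run r v q' := by
  induction u generalizing q with
  | nil =>
    refine ⟨fun h => ⟨q, .nil q, h⟩, ?_⟩
    rintro ⟨r, hr, h⟩
    cases hr
    exact h
  | cons l u ih =>
    constructor
    · intro h
      cases h with
      | cons hs h =>
        obtain ⟨r, h₁, h₂⟩ := ih.1 h
        exact ⟨r, .cons hs h₁, h₂⟩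
    · rintro ⟨r, h₁, h₂⟩
      cases h₁ with
      | cons hs h => exact .cons hs (ih.2 ⟨r, h, h₂⟩)

/-- Long iterations of a letter can be pumped by multiples of one period, uniformly in the states:
the reachability relations of `lⁿ`, of which there are finitely many, are eventually periodic. -/
theorem exists_pump (A : VA α Var) (l : Label α Var) :
    ∃ N p, 0 < p ∧ ∀ n, N ≤ n → ∀ c, p ∣ c → ∀ q q', A.Run q (List.replicate n l) q' →
      A.Run q (List.replicate (n + c) l) q' := by
  have := A.finite_state
  let R : ℕ → Set (A.State × A.State) := fun n => {q | A.Run q.1 (List.replicate n l) q.2}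
  obtain ⟨i, j, hij, hR⟩ : ∃ i j, i < j ∧ R i = R j := by
    obtain ⟨i, j, hij, hR⟩ := Finite.exists_ne_map_eq_of_infinite R
    rcases hij.lt_or_gt with h | h
    · exact ⟨i, j, h, hR⟩
    · exact ⟨j, i, h, hR.symm⟩
  refine ⟨i, j - i, by omega, ?_⟩
  have step : ∀ n, i ≤ n → ∀ q q', A.Run q (List.replicate n l) q' →
      A.Run q (List.replicate (n + (j - i)) l) q' := by
    intro n hn q q' h
    obtain ⟨t, rfl⟩ := Nat.exists_eq_add_of_le hn
    rw [List.replicate_add, run_append] at h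
    obtain ⟨r, h₁, h₂⟩ := h
    rw [show i + t + (j - i) = j + t by omega, List.replicate_add, run_append]
    refine ⟨r, ?_, h₂⟩
    have : (q, r) ∈ R j := hR ▸ h₁
    exact this
  rintro n hn c ⟨k, rfl⟩ q q' h
  induction k with
  | zero => simpa using h
  | succ k ih =>
    rw [Nat.mul_succ, ← Nat.add_assoc]
    exact step _ (by omega) _ _ ih

end VA

/-! ### Documents made of blocks -/

/-- The block `b aⁿ b`. -/
def block (a b : α) (n : ℕ) : List α := b :: (List.replicate n a ++ [b])

/-- The document that concatenates the blocks `b aⁿ b` for the entries `n` of `ns`. -/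
def doc (a b : α) (ns : List ℕ) : List α := ns.flatMap (block a b)

theorem length_block (a b : α) (n : ℕ) : (block a b n).length = n + 2 := by simp [block]

@[simp]
theorem doc_nil (a b : α) : doc a b [] = [] := rfl

@[simp]
theorem doc_cons (a b : α) (n : ℕ) (ns : List ℕ) :
    doc a b (n :: ns) = block a b n ++ doc a b ns := rfl

@[simp]
theorem doc_append (a b : α) (ms ns : List ℕ) :
    doc a b (ms ++ ns) = doc a b ms ++ doc a b ns := by simp [doc]

theorem append_cons_eq_append_cons {β : Type*} {b : β} {x u r r' : List β} (hx : b ∉ x)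
    (h : x ++ b :: r = u ++ b :: r') :
    (u = x ∧ r = r') ∨ ∃ u', u = x ++ b :: u' ∧ r = u' ++ b :: r' := by
  rcases List.append_eq_append_iff.1 h with ⟨e, rfl, he⟩ | ⟨e, rfl, he⟩
  · cases e with
    | nil => simp_all
    | cons c e =>
      simp only [List.cons_append, List.cons.injEq] at he
      exact Or.inr ⟨e, by rw [he.1], he.2⟩
  · cases e with
    | nil => simp_all
    | cons c e =>
      simp only [List.cons_append, List.cons.injEq] at he
      simp [he.1] at hx

/-- A block `b aⁿ b` with `n ≥ 1` occurs in a document made of blocks only as one of these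
blocks. (For `n = 0` it also occurs where two blocks meet.) -/
theorem exists_of_doc_eq {a b : α} (hab : a ≠ b) {n : ℕ} (hn : 1 ≤ n) {ns : List ℕ}
    {u v : List α} (h : doc a b ns = u ++ (block a b n ++ v)) :
    ∃ ms ls, ns = ms ++ n :: ls ∧ u = doc a b ms := by
  have hb : ∀ k, b ∉ List.replicate k a := fun k hk => hab (List.eq_of_mem_replicate hk).symm
  induction ns generalizing u with
  | nil => simp [block] at h
  | cons k ns ih =>
    cases u with
    | nil =>
      simp only [doc_cons, block, List.cons_append, List.append_assoc, List.nil_append,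
        List.cons.injEq, true_and] at h
      rcases append_cons_eq_append_cons (hb k) h with ⟨h1, -⟩ | ⟨u', h1, -⟩
      · have := congrArg List.length h1
        simp only [List.length_replicate] at this
        exact ⟨[], ns, by simp [this], rfl⟩
      · exact absurd (by rw [h1]; simp) (hb n)
    | cons e u =>
      simp only [doc_cons, block, List.cons_append, List.append_assoc, List.nil_append,
        List.cons.injEq] at h
      obtain ⟨rfl, h⟩ := h
      rcases append_cons_eq_append_cons (hb k) h with ⟨-, h1⟩ | ⟨u', rfl, h1⟩
      · -- the next block would start with the letter `a`
        exfalso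
        obtain ⟨n, rfl⟩ := Nat.exists_eq_add_of_le' hn
        cases ns with
        | nil => simp [List.replicate_succ] at h1
        | cons k' ns =>
          simp only [doc_cons, block, List.replicate_succ, List.cons_append,
            List.cons.injEq] at h1
          exact hab h1.1.symm
      · obtain ⟨ms, ls, rfl, rfl⟩ := ih (u := u') (by simpa [block] using h1)
        exact ⟨k :: ms, ls, rfl, by simp [block]⟩

/-! ### Pumping for core spanners -/

/-- A spanner is pumpable if it uses finitely many variables and there are a threshold `N`, a period
`p` and a bound `k` such that, for every captured mapping on a document with pairwise distinct
blocks `b aⁿ b`, all but `k` of the blocks can be pumped: if `n ≥ N`, then `n` may be increased by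
any multiple `c` of `p`, and the mapping, shifted accordingly, is still captured. -/
def Pumpable (a b : α) (P : Spanner α Var) : Prop :=
  P.svars.Finite ∧ ∃ N p k : ℕ, 0 < p ∧ ∀ ns : List ℕ, ns.Nodup → ∀ m ∈ P.toFun (doc a b ns),
    ∃ B : Finset ℕ, B.card ≤ k ∧ ∀ ms n ls, ns = ms ++ n :: ls → ms.length ∉ B → N ≤ n →
      ∀ c, p ∣ c → m.shift (doc a b ms).length c ∈ P.toFun (doc a b (ms ++ (n + c) :: ls))

/-- Few blocks have one of the positions in `E` in their interior. -/
theorem exists_finset_of_interior (a b : α) (ns : List ℕ) (E : Finset ℕ) :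
    ∃ B : Finset ℕ, B.card ≤ E.card ∧ ∀ ms n ls, ns = ms ++ n :: ls → ms.length ∉ B →
      ∀ e ∈ E, e ≤ (doc a b ms).length ∨ (doc a b ms).length + (n + 2) ≤ e := by
  classical
  let s : ℕ → ℕ := fun i => (doc a b (ns.take i)).length
  have hs : Monotone s := by
    intro i j h
    obtain ⟨r, rfl⟩ := Nat.exists_eq_add_of_le h
    simp [s, List.take_add]
  refine ⟨(Finset.range ns.length).filter fun i => ∃ e ∈ E, s i < e ∧ e < s (i + 1), ?_, ?_⟩
  · have : ∀ i, ∃ e, (∃ e ∈ E, s i < e ∧ e < s (i + 1)) → e ∈ E ∧ s i < e ∧ e < s (i + 1) := by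
      intro i
      by_cases h : ∃ e ∈ E, s i < e ∧ e < s (i + 1)
      · obtain ⟨e, he⟩ := h
        exact ⟨e, fun _ => he⟩
      · exact ⟨0, fun h' => absurd h' h⟩
    choose f hf using this
    refine Finset.card_le_card_of_injOn f ?_ ?_
    · intro i hi
      exact (hf i (Finset.mem_filter.1 hi).2).1
    · intro i hi j hj hij
      have h1 := (hf i (Finset.mem_filter.1 hi).2).2
      have h2 := (hf j (Finset.mem_filter.1 hj).2).2
      rw [hij] at h1
      by_contra hne
      rcases Nat.lt_or_gt_of_ne hne with h | h
      · have := hs (show i + 1 ≤ j from h)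
        omega
      · have := hs (show j + 1 ≤ i from h)
        omega
  · rintro ms n ls rfl hB e he
    by_contra! hlt
    refine hB (Finset.mem_filter.2 ⟨by simp, e, he, ?_⟩)
    have e1 : s ms.length = (doc a b ms).length := by simp [s]
    have e2 : s (ms.length + 1) = (doc a b ms).length + (n + 2) := by
      simp [s, List.take_append, length_block, List.take_of_length_le]
    omega

/-- The end points of the spans of a mapping. -/
theorem Mapping.exists_endpoints {V : Set Var} (hV : V.Finite) {m : Mapping Var} (hm : m.dom ⊆ V) :
    ∃ E : Finset ℕ, E.card ≤ 2 * V.ncard ∧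
      ∀ x t, m.toFun x = some t → t.lo ∈ E ∧ t.hi ∈ E := by
  classical
  lift V to Finset Var using hV
  refine ⟨V.biUnion fun x => ((m.toFun x).map fun t => ({t.lo, t.hi} : Finset ℕ)).getD ∅, ?_, ?_⟩
  · rw [Set.ncard_coe_finset, mul_comm]
    refine Finset.card_biUnion_le_card_mul _ _ _ fun x _ => ?_
    cases m.toFun x with
    | none => simp
    | some t => exact Finset.card_le_two
  · intro x t ht
    have hx : x ∈ V := hm ⟨t, ht⟩
    simp only [Finset.mem_biUnion]
    exact ⟨⟨x, hx, by simp [ht]⟩, ⟨x, hx, by simp [ht]⟩⟩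

/-- All but boundedly many blocks of a document have no end point of a span of `m` in their
interior. -/
theorem Mapping.exists_untouched (a b : α) (ns : List ℕ) {V : Set Var} (hV : V.Finite)
    {m : Mapping Var} (hm : m.dom ⊆ V) :
    ∃ B : Finset ℕ, B.card ≤ 2 * V.ncard ∧ ∀ ms n ls, ns = ms ++ n :: ls → ms.length ∉ B →
      ∀ x t, m.toFun x = some t →
        (t.lo ≤ (doc a b ms).length ∨ (doc a b ms).length + (n + 2) ≤ t.lo) ∧
        (t.hi ≤ (doc a b ms).length ∨ (doc a b ms).length + (n + 2) ≤ t.hi) := by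
  obtain ⟨E, hE, h⟩ := m.exists_endpoints hV hm
  obtain ⟨B, hB, h'⟩ := exists_finset_of_interior a b ns E
  exact ⟨B, hB.trans hE, fun ms n ls e hms x t ht =>
    ⟨h' ms n ls e hms _ (h x t ht).1, h' ms n ls e hms _ (h x t ht).2⟩⟩

theorem Spanner.dom_subset_svars {P : Spanner α Var} {d : List α} {m : Mapping Var}
    (hm : m ∈ P.toFun d) : m.dom ⊆ P.svars := fun _ hx => ⟨d, m, hm, hx⟩

theorem VA.dom_subset_vars {A : VA α Var} {d : List α} {m : Mapping Var}
    (hm : m ∈ A.spanner.toFun d) : m.dom ⊆ A.vars := by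
  obtain ⟨w, ⟨q, -, hr⟩, rfl, hm⟩ := hm
  rintro x ⟨s, hs⟩
  rcases hm x with ⟨_, h⟩ | ⟨u, v, t, ⟨rfl, -⟩, -⟩
  · simp [h] at hs
  · exact hr.mem_vars (x := x) (by simp)

/-- If the mapping defined by `w` has no end point strictly inside an occurrence of the word
`c D e` in the document, then `D` is read by `w` without interruption by markers. -/
theorem Defines.exists_eq_append {w : List (Label α Var)} {m : Mapping Var} (hm : Defines w m)
    {u v D : List α} {c e : α} (hw : letters w = u ++ (c :: (D ++ [e]) ++ v))
    (h : ∀ x t, m.toFun x = some t → (t.lo ≤ u.length ∨ u.length + (D.length + 2) ≤ t.lo) ∧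
      (t.hi ≤ u.length ∨ u.length + (D.length + 2) ≤ t.hi)) :
    ∃ w₁ w₂, w = w₁ ++ (Label.letter c :: (D.map Label.letter ++ Label.letter e :: w₂)) ∧
      letters w₁ = u ∧ letters w₂ = v := by
  obtain ⟨w₁, w', rfl, rfl, hw'⟩ := exists_of_letters_eq_append_cons (u := u) (c := c)
    (t := D ++ e :: v) (by simpa using hw)
  obtain ⟨w₃, w₂, rfl, rfl, hv⟩ := exists_of_letters_eq_append_cons hw'
  refine ⟨w₁, w₂, ?_, rfl, hv⟩
  suffices ∀ x, Label.opening x ∉ w₃ ∧ Label.closing x ∉ w₃ by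
    rw [← eq_map_letter_letters this]
  intro x
  constructor
  · intro hx
    obtain ⟨f, g, rfl⟩ := List.append_of_mem hx
    rcases hm x with ⟨h', -⟩ | ⟨u, v, t, hr, ht⟩
    · exact h'.1 (by simp)
    · have := hr.opening_unique (u' := w₁ ++ Label.letter c :: f)
        (r := g ++ Label.letter e :: w₂) (by simp)
      subst this
      have := (h x _ ht).1
      simp only [letters_append, letters, List.length_append, List.length_cons] at this
      omega
  · intro hx
    obtain ⟨f, g, rfl⟩ := List.append_of_mem hx
    rcases hm x with ⟨h', -⟩ | ⟨u, v, t, hr, ht⟩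
    · exact h'.2 (by simp)
    · have e1 := hr.closing_unique (u' := w₁ ++ Label.letter c :: f)
        (r := g ++ Label.letter e :: w₂) (by simp)
      have e2 := congrArg (fun w => (letters w).length) e1
      have := (h x _ ht).2
      simp only [letters_append, letters, List.length_append, List.length_cons] at this e2
      omega

/-- The blocks that may not be pumped are those with an end point of a span in their interior. -/
theorem VA.pumpable (a b : α) (A : VA α Var) : Pumpable a b A.spanner := by
  refine ⟨A.finite_vars.subset ?_, ?_⟩
  · rintro x ⟨d, m, hm, hx⟩
    exact VA.dom_subset_vars hm hx
  obtain ⟨N, p, hp, hpump⟩ := A.exists_pump (.letter a)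
  refine ⟨N, p, 2 * A.vars.ncard, hp, fun ns _ m hm => ?_⟩
  obtain ⟨B, hB, h⟩ := m.exists_untouched a b ns A.finite_vars (VA.dom_subset_vars hm)
  refine ⟨B, hB, ?_⟩
  rintro ms n ls rfl hms hn c hc
  obtain ⟨w, ⟨q, hq, hr⟩, hw, hm⟩ := hm
  obtain ⟨w₁, w₂, rfl, hw₁, hw₂⟩ := hm.exists_eq_append (D := List.replicate n a)
    (u := doc a b ms) (v := doc a b ls) (c := b) (e := b) (by simpa [block] using hw)
    (by simpa using h ms n ls rfl hms)
  refine ⟨w₁ ++ (Label.letter b :: ((List.replicate (n + c) a).map Label.letter ++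
    Label.letter b :: w₂)), ⟨q, hq, ?_⟩, ?_, ?_⟩
  · obtain ⟨q₁, h₁, hr⟩ := VA.run_append.1 hr
    refine VA.run_append.2 ⟨q₁, h₁, ?_⟩
    cases hr with
    | cons hs hr =>
      obtain ⟨q₂, h₂, hr⟩ := VA.run_append.1 hr
      refine .cons hs (VA.run_append.2 ⟨q₂, ?_, hr⟩)
      rw [List.map_replicate] at h₂ ⊢
      exact hpump n hn c hc _ _ h₂
  · simp [letters_append, letters, hw₁, hw₂, block, -List.map_replicate]
  · rw [← hw₁]
    have := Defines.shift (w₁ := w₁) (w₂ := w₂) (D := b :: (List.replicate n a ++ [b]))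
      (D' := b :: (List.replicate (n + c) a ++ [b])) (c := c) (m := m) (by simpa using hm)
      (by simp) (by simp; omega)
    simpa using this

namespace Pumpable

variable {a b : α} {P P₁ P₂ : Spanner α Var}

theorem proj (h : Pumpable a b P) (Y : Set Var) : Pumpable a b (P.proj Y) := by
  obtain ⟨hf, N, p, k, hp, h⟩ := h
  refine ⟨hf.subset ?_, N, p, k, hp, ?_⟩
  · rintro x ⟨d, _, ⟨m, hm, rfl⟩, s, hs⟩
    refine ⟨d, m, hm, s, ?_⟩
    by_cases hx : x ∈ Y
    · simpa [Mapping.restrict, hx] using hs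
    · simp [Mapping.restrict, hx] at hs
  · rintro ns hns _ ⟨m, hm, rfl⟩
    obtain ⟨B, hB, h⟩ := h ns hns m hm
    refine ⟨B, hB, fun ms n ls e hms hn c hc => ⟨_, h ms n ls e hms hn c hc, ?_⟩⟩
    exact (Mapping.restrict_shift _ _ _ _).symm

theorem union (h₁ : Pumpable a b P₁) (h₂ : Pumpable a b P₂) : Pumpable a b (P₁.union P₂) := by
  obtain ⟨hf₁, N₁, p₁, k₁, hp₁, h₁⟩ := h₁
  obtain ⟨hf₂, N₂, p₂, k₂, hp₂, h₂⟩ := h₂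
  refine ⟨(hf₁.union hf₂).subset ?_, max N₁ N₂, p₁ * p₂, max k₁ k₂, Nat.mul_pos hp₁ hp₂, ?_⟩
  · rintro x ⟨d, m, hm | hm, hx⟩
    · exact Or.inl ⟨d, m, hm, hx⟩
    · exact Or.inr ⟨d, m, hm, hx⟩
  · rintro ns hns m (hm | hm)
    · obtain ⟨B, hB, h⟩ := h₁ ns hns m hm
      exact ⟨B, hB.trans (le_max_left _ _), fun ms n ls e hms hn c hc => Or.inl
        (h ms n ls e hms ((le_max_left _ _).trans hn) c ((Dvd.intro _ rfl).trans hc))⟩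
    · obtain ⟨B, hB, h⟩ := h₂ ns hns m hm
      exact ⟨B, hB.trans (le_max_right _ _), fun ms n ls e hms hn c hc => Or.inr
        (h ms n ls e hms ((le_max_right _ _).trans hn) c ((Dvd.intro_left _ rfl).trans hc))⟩

theorem join (h₁ : Pumpable a b P₁) (h₂ : Pumpable a b P₂) : Pumpable a b (P₁.join P₂) := by
  classical
  obtain ⟨hf₁, N₁, p₁, k₁, hp₁, h₁⟩ := h₁
  obtain ⟨hf₂, N₂, p₂, k₂, hp₂, h₂⟩ := h₂
  refine ⟨(hf₁.union hf₂).subset ?_, max N₁ N₂, p₁ * p₂, k₁ + k₂, Nat.mul_pos hp₁ hp₂, ?_⟩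
  · rintro x ⟨d, m, ⟨m₁, hm₁, m₂, hm₂, -, -, hd⟩, hx⟩
    rw [← hd] at hx
    exact hx.imp (fun hx => ⟨d, m₁, hm₁, hx⟩) (fun hx => ⟨d, m₂, hm₂, hx⟩)
  · rintro ns hns m ⟨m₁, hm₁, m₂, hm₂, c₁, c₂, hd⟩
    obtain ⟨B₁, hB₁, h₁⟩ := h₁ ns hns m₁ hm₁
    obtain ⟨B₂, hB₂, h₂⟩ := h₂ ns hns m₂ hm₂
    refine ⟨B₁ ∪ B₂, (Finset.card_union_le _ _).trans (Nat.add_le_add hB₁ hB₂),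
      fun ms n ls e hms hn c hc => ?_⟩
    rw [Finset.mem_union, not_or] at hms
    refine ⟨_, h₁ ms n ls e hms.1 ((le_max_left _ _).trans hn) c ((Dvd.intro _ rfl).trans hc),
      _, h₂ ms n ls e hms.2 ((le_max_right _ _).trans hn) c ((Dvd.intro_left _ rfl).trans hc),
      c₁.shift _ _, c₂.shift _ _, ?_⟩
    simp only [Mapping.dom_shift, hd]

end Pumpable

/-! ### String equality and pumping -/

theorem content_append_left {u v : List α} {t : Span} (h : t.hi ≤ u.length) :
    content (u ++ v) t = content u t := by
  have := t.le
  simp only [content]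
  rw [List.drop_append_of_le_length (by omega),
    List.take_append_of_le_length (by rw [List.length_drop]; omega)]

theorem content_append_right {u v : List α} {t t' : Span} (h : t.lo = u.length + t'.lo)
    (h' : t.hi = u.length + t'.hi) : content (u ++ v) t = content v t' := by
  simp only [content, h, h', List.drop_append]
  rw [List.drop_eq_nil_of_le (by omega), List.nil_append]
  congr 1
  · omega
  · congr 1
    omega

theorem length_content {d : List α} {t : Span} (h : t.hi ≤ d.length) :
    (content d t).length = t.hi - t.lo := by
  have := t.le
  simp only [content, List.length_take, List.length_drop]
  omega

theorem eq_take_append_content (d : List α) {t : Span} :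
    d = d.take t.lo ++ (content d t ++ d.drop t.hi) := by
  have := t.le
  have e : d.drop t.hi = (d.drop t.lo).drop (t.hi - t.lo) := by
    rw [List.drop_drop]
    congr 1
    omega
  rw [content, e, List.take_append_drop, List.take_append_drop]

/-- The contents of a span outside the factor `x` does not change when `x` is replaced. -/
theorem content_shift {u v x x' : List α} {t : Span} {c : ℕ} (hc : x'.length = x.length + c)
    (hx : 0 < x.length) (h : t.hi ≤ u.length ∨ u.length + x.length ≤ t.lo) :
    content (u ++ (x' ++ v)) (t.shift u.length c) = content (u ++ (x ++ v)) t := by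
  have ht := t.le
  rcases h with h | h
  · have : t.shift u.length c = t := by
      ext
      · exact shiftPos_of_le _ (by omega)
      · exact shiftPos_of_le _ h
    rw [this, content_append_left h, content_append_left h]
  · have e1 : shiftPos u.length c t.lo = t.lo + c := shiftPos_of_lt _ (by omega)
    have e2 : shiftPos u.length c t.hi = t.hi + c := shiftPos_of_lt _ (by omega)
    let t' : Span := ⟨t.lo - (u.length + x.length), t.hi - (u.length + x.length), by omega⟩
    rw [← List.append_assoc, ← List.append_assoc,
      content_append_right (u := u ++ x') (t := t.shift u.length c) (t' := t'),
      content_append_right (u := u ++ x) (t := t) (t' := t')]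
    all_goals
      simp only [Span.shift, e1, e2, t', List.length_append]
      omega

/-- A span that covers one of several distinct blocks is the only span with its contents. -/
theorem eq_of_content_eq {a b : α} (hab : a ≠ b) {ms ls : List ℕ} {n : ℕ} (hn : 1 ≤ n)
    (hnd : (ms ++ n :: ls).Nodup) {s t : Span} (hs : s.hi ≤ (doc a b (ms ++ n :: ls)).length)
    (ht : t.hi ≤ (doc a b (ms ++ n :: ls)).length) (h₁ : s.lo ≤ (doc a b ms).length)
    (h₂ : (doc a b ms).length + (n + 2) ≤ s.hi)
    (h : content (doc a b (ms ++ n :: ls)) s = content (doc a b (ms ++ n :: ls)) t) : s = t := by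
  have hl := length_content hs
  rw [h, length_content ht] at hl
  have hsle := s.le
  have htle := t.le
  set d := doc a b (ms ++ n :: ls) with hd
  -- the contents of `s` contain the block, at offset `|doc ms| - s.lo`
  obtain ⟨y, z, hy, hyl⟩ : ∃ y z, content d s = y ++ (block a b n ++ z) ∧
      y.length = (doc a b ms).length - s.lo := by
    have h4 : d = doc a b ms ++ (block a b n ++ doc a b ls) := by simp [hd]
    refine ⟨(doc a b ms).drop s.lo,
      (doc a b ls).take (s.hi - ((doc a b ms).length + (n + 2))), ?_, by simp⟩
    rw [content, h4, List.drop_append_of_le_length h₁, List.take_append, List.take_append,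
      List.take_of_length_le (by rw [List.length_drop]; omega),
      List.take_of_length_le (by rw [List.length_drop, length_block]; omega)]
    congr 3
    rw [List.length_drop, length_block]
    omega
  have h5 : d = (d.take t.lo ++ y) ++ (block a b n ++ (z ++ d.drop t.hi)) := by
    conv_lhs => rw [eq_take_append_content d (t := t), ← h, hy]
    simp
  obtain ⟨ms', ls', e, he⟩ := exists_of_doc_eq hab hn h5
  have : ms' = ms := by
    have h6 : n ∉ ms' := by
      rw [e] at hnd
      exact fun h => (List.nodup_append.1 hnd).2.2 n h n (by simp) rfl
    have h7 : n ∉ ls' := by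
      rw [e] at hnd
      exact (List.nodup_cons.1 (List.nodup_append.1 hnd).2.1).1
    exact (((List.append_cons_inj_of_notMem h6 h7).1 e.symm).1)
  subst this
  have h8 := congrArg List.length he
  rw [List.length_append, hyl, List.length_take] at h8
  ext <;> omega

/-- String equality selection preserves pumpability: if no span of `m` has an end point in the
interior of the pumped block, then two spans with equal contents either both lie outside the block
or coincide. -/
theorem Pumpable.eqSel {a b : α} (hab : a ≠ b) {P : Spanner α Var} (h : Pumpable a b P)
    (Y : Set Var) : Pumpable a b (P.eqSel Y) := by
  classical
  obtain ⟨hf, N, p, k, hp, h⟩ := h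
  -- the threshold is at least `1` because `b b` occurs wherever two blocks meet
  refine ⟨hf.subset ?_, N + 1, p, k + 2 * P.svars.ncard, hp, ?_⟩
  · rintro x ⟨d, m, hm, hx⟩
    exact ⟨d, m, hm.1, hx⟩
  · rintro ns hns m ⟨hm, heq⟩
    obtain ⟨B, hB, h⟩ := h ns hns m hm
    obtain ⟨B', hB', h'⟩ := m.exists_untouched a b ns hf (Spanner.dom_subset_svars hm)
    refine ⟨B ∪ B', (Finset.card_union_le _ _).trans (Nat.add_le_add hB hB'),
      fun ms n ls e hms hn c hc => ?_⟩
    rw [Finset.mem_union, not_or] at hms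
    refine ⟨h ms n ls e hms.1 (by omega) c hc, ?_⟩
    intro x hx y hy s' t' hs ht
    obtain ⟨s, hs', rfl⟩ := Option.map_eq_some_iff.1 hs
    obtain ⟨t, ht', rfl⟩ := Option.map_eq_some_iff.1 ht
    have hst := heq x hx y hy s t hs' ht'
    have h₁ := h' ms n ls e hms.2 x s hs'
    have h₂ := h' ms n ls e hms.2 y t ht'
    have o₁ := P.isOver _ m hm x s hs'
    have o₂ := P.isOver _ m hm y t ht'
    have l₁ := s.le
    have l₂ := t.le
    subst e
    have key : ∀ r : Span, (r.hi ≤ (doc a b ms).length ∨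
        (doc a b ms).length + (n + 2) ≤ r.lo) →
        content (doc a b (ms ++ (n + c) :: ls)) (r.shift (doc a b ms).length c) =
          content (doc a b (ms ++ n :: ls)) r := by
      intro r hr
      simp only [doc_append, doc_cons]
      exact content_shift (by simp only [length_block]; omega) (by simp [length_block])
        (by simpa [length_block] using hr)
    by_cases c₁ : s.hi ≤ (doc a b ms).length ∨ (doc a b ms).length + (n + 2) ≤ s.lo
    · by_cases c₂ : t.hi ≤ (doc a b ms).length ∨ (doc a b ms).length + (n + 2) ≤ t.lo
      · rw [key s c₁, key t c₂, hst]
      · rw [eq_of_content_eq hab (by omega) hns o₂ o₁ (by omega) (by omega) hst.symm]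
    · rw [eq_of_content_eq hab (by omega) hns o₁ o₂ (by omega) (by omega) hst]

theorem Spanner.IsCore.pumpable {a b : α} (hab : a ≠ b) {P : Spanner α Var} (h : P.IsCore) :
    Pumpable a b P := by
  induction h with
  | regular h =>
    obtain ⟨A, -, rfl⟩ := h
    exact A.pumpable a b
  | proj Y _ _ ih => exact ih.proj Y
  | union _ _ ih₁ ih₂ => exact ih₁.union ih₂
  | join _ _ ih₁ ih₂ => exact ih₁.join ih₂
  | eqSel Y _ ih => exact ih.eqSel hab Y

/-! ### Automata from patterns -/

/-- An item of a pattern: a single label, or the iteration of a set of letters. -/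
inductive Item (α Var : Type*) where
  | label (l : Label α Var)
  | star (S : Set α)

/-- The label sequence `w` matches the concatenation of the items of the pattern. -/
def Matches : List (Item α Var) → List (Label α Var) → Prop
  | [], w => w = []
  | .label l :: p, w => ∃ w', w = l :: w' ∧ Matches p w'
  | .star S :: p, w => ∃ u : List α, (∀ c ∈ u, c ∈ S) ∧
      ∃ w', w = u.map Label.letter ++ w' ∧ Matches p w'

/-- Reading the label `l` turns the pattern `p`, which remains to be matched, into `p'`. -/
inductive PatternStep : List (Item α Var) → Label α Var → List (Item α Var) → Prop
  | label (l : Label α Var) (p : List (Item α Var)) : PatternStep (.label l :: p) l p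
  | loop {S : Set α} {c : α} (p : List (Item α Var)) :
      c ∈ S → PatternStep (.star S :: p) (.letter c) (.star S :: p)
  | skip {S : Set α} {l : Label α Var} {p p' : List (Item α Var)} :
      PatternStep p l p' → PatternStep (.star S :: p) l p'

theorem matches_cons_iff {p : List (Item α Var)} {l : Label α Var} {w : List (Label α Var)} :
    Matches p (l :: w) ↔ ∃ p', PatternStep p l p' ∧ Matches p' w := by
  constructor
  · intro h
    induction p with
    | nil => simp [Matches] at h
    | cons i p ih =>
      cases i with
      | label l' =>
        obtain ⟨w', e, h⟩ := h
        simp only [List.cons.injEq] at e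
        obtain ⟨rfl, rfl⟩ := e
        exact ⟨p, .label _ _, h⟩
      | star S =>
        obtain ⟨u, hu, w', e, h⟩ := h
        cases u with
        | nil =>
          simp only [List.map_nil, List.nil_append] at e
          subst e
          obtain ⟨p', h₁, h₂⟩ := ih h
          exact ⟨p', .skip h₁, h₂⟩
        | cons c u =>
          simp only [List.map_cons, List.cons_append, List.cons.injEq] at e
          obtain ⟨rfl, rfl⟩ := e
          exact ⟨_, .loop p (hu c (by simp)), u, fun c hc => hu c (by simp [hc]), w', rfl, h⟩
  · rintro ⟨p', hs, h⟩
    induction hs with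
    | label l p => exact ⟨w, rfl, h⟩
    | loop p hc =>
      obtain ⟨u, hu, w', rfl, h⟩ := h
      exact ⟨_ :: u, by simpa using ⟨hc, hu⟩, w', rfl, h⟩
    | skip _ ih => exact ⟨[], by simp, _, rfl, ih h⟩

theorem PatternStep.isSuffix {p p' : List (Item α Var)} {l : Label α Var} (h : PatternStep p l p') :
    p' <:+ p := by
  induction h with
  | label l p => exact List.suffix_cons _ _
  | loop p _ => exact List.suffix_refl _
  | skip _ ih => exact ih.trans (List.suffix_cons _ _)

theorem PatternStep.mem {p p' : List (Item α Var)} {l : Label α Var} (h : PatternStep p l p')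
    (hl : ∀ c, l ≠ .letter c) : Item.label l ∈ p := by
  induction h with
  | label l p => simp
  | loop p _ => exact absurd rfl (hl _)
  | skip _ ih => exact List.mem_cons_of_mem _ (ih hl)

/-- The automaton of a pattern. In state `i`, the pattern without its first `i` items remains to be
matched. -/
def patternVA (p : List (Item α Var)) : VA α Var where
  State := Fin (p.length + 1)
  finite_state := inferInstance
  start := 0
  accept := {i | Matches (p.drop i) []}
  vars := {x | .label (.opening x) ∈ p ∨ .label (.closing x) ∈ p}
  finite_vars := by
    have h₁ := (List.finite_toSet p).preimage (f := fun x => Item.label (.opening x))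
      fun x _ y _ h => by simpa using h
    have h₂ := (List.finite_toSet p).preimage (f := fun x => Item.label (.closing x))
      fun x _ y _ h => by simpa using h
    exact h₁.union h₂
  step := {t | PatternStep (p.drop t.1) t.2.1 (p.drop t.2.2)}
  opening_mem q x q' h := Or.inl (List.mem_of_mem_drop (PatternStep.mem h (by simp)))
  closing_mem q x q' h := Or.inr (List.mem_of_mem_drop (PatternStep.mem h (by simp)))

/-- The automaton has no silent transitions, so iterations are left by reading a label of a later
item, or by accepting. -/
theorem patternVA_accepts {p : List (Item α Var)} {w : List (Label α Var)} :
    (patternVA p).Accepts w ↔ Matches p w := by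
  suffices ∀ i : (patternVA p).State,
      (∃ q ∈ (patternVA p).accept, (patternVA p).Run i w q) ↔ Matches (p.drop i.val) w from
    this (0 : Fin (p.length + 1))
  induction w with
  | nil =>
    intro i
    constructor
    · rintro ⟨q, hq, hr⟩
      cases hr
      exact hq
    · exact fun h => ⟨i, h, .nil i⟩
  | cons l w ih =>
    intro i
    rw [matches_cons_iff]
    constructor
    · rintro ⟨q, hq, hr⟩
      cases hr with
      | cons hs hr => exact ⟨_, hs, (ih _).1 ⟨q, hq, hr⟩⟩
    · rintro ⟨p', hs, h⟩
      have hp' : p' = p.drop (p.length - p'.length) :=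
        List.suffix_iff_eq_drop.1 (hs.isSuffix.trans (List.drop_suffix _ _))
      let j : (patternVA p).State := ⟨p.length - p'.length, by omega⟩
      rw [hp'] at h hs
      obtain ⟨q, hq, hr⟩ := (ih j).2 h
      have hs' : (i, l, j) ∈ (patternVA p).step := hs
      exact ⟨q, hq, .cons hs' hr⟩

/-! ### Repeated blocks -/

theorem unread_map_letter (u : List α) (x : Var) : Unread (u.map Label.letter) x := by
  simp [Unread]

/-- The pattern `Σ*`. -/
def anyPattern (α Var : Type*) : List (Item α Var) := [.star Set.univ]

/-- The pattern `z{} Σ*`. -/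
def startPattern (α : Type*) {Var : Type*} (z : Var) : List (Item α Var) :=
  [.label (.opening z), .label (.closing z), .star Set.univ]

/-- The pattern `z{Σ* x{b a a* b} Σ* y{b a a* b} Σ*}`. -/
def twoBlocksPattern (a b : α) (x y z : Var) : List (Item α Var) :=
  [.label (.opening z), .star Set.univ,
    .label (.opening x), .label (.letter b), .label (.letter a), .star {a}, .label (.letter b),
    .label (.closing x), .star Set.univ,
    .label (.opening y), .label (.letter b), .label (.letter a), .star {a}, .label (.letter b),
    .label (.closing y), .star Set.univ, .label (.closing z)]

/-- The label sequence `z{u₁ x{b aⁱ b} u₂ y{b aʲ b} u₃}`. -/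
def twoBlocksWord (a b : α) (x y z : Var) (u₁ u₂ u₃ : List α) (i j : ℕ) : List (Label α Var) :=
  .opening z :: (u₁.map .letter ++ .opening x :: ((block a b i).map .letter ++
    .closing x :: (u₂.map .letter ++ .opening y :: ((block a b j).map .letter ++
      .closing y :: (u₃.map .letter ++ [.closing z])))))

theorem matches_anyPattern {w : List (Label α Var)} :
    Matches (anyPattern α Var) w ↔ ∃ u : List α, w = u.map .letter := by
  simp [Matches, anyPattern]

theorem matches_startPattern {z : Var} {w : List (Label α Var)} :
    Matches (startPattern α z) w ↔
      ∃ u : List α, w = .opening z :: .closing z :: u.map .letter := by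
  simp [Matches, startPattern]

theorem matches_twoBlocksPattern {a b : α} {x y z : Var} {w : List (Label α Var)} :
    Matches (twoBlocksPattern a b x y z) w ↔
      ∃ u₁ u₂ u₃ i j, 1 ≤ i ∧ 1 ≤ j ∧ w = twoBlocksWord a b x y z u₁ u₂ u₃ i j := by
  simp only [Matches, twoBlocksPattern]
  constructor
  · rintro ⟨_, rfl, u₁, -, _, rfl, _, rfl, _, rfl, _, rfl, v, hv, _, rfl, _, rfl, _, rfl, u₂, -,
      _, rfl, _, rfl, _, rfl, _, rfl, v', hv', _, rfl, _, rfl, _, rfl, u₃, -, _, rfl, _, rfl, rfl⟩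
    refine ⟨u₁, u₂, u₃, v.length + 1, v'.length + 1, by omega, by omega, ?_⟩
    rw [List.eq_replicate_of_mem hv, List.eq_replicate_of_mem hv']
    simp [twoBlocksWord, block, List.replicate_succ]
  · rintro ⟨u₁, u₂, u₃, i, j, hi, hj, rfl⟩
    obtain ⟨i, rfl⟩ := Nat.exists_eq_add_of_le' hi
    obtain ⟨j, rfl⟩ := Nat.exists_eq_add_of_le' hj
    have hw : twoBlocksWord a b x y z u₁ u₂ u₃ (i + 1) (j + 1) =
        .opening z :: (u₁.map .letter ++ .opening x :: .letter b :: .letter a ::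
          ((List.replicate i a).map .letter ++ .letter b :: .closing x :: (u₂.map .letter ++
            .opening y :: .letter b :: .letter a :: ((List.replicate j a).map .letter ++
              .letter b :: .closing y :: (u₃.map .letter ++ [.closing z]))))) := by
      simp [twoBlocksWord, block, List.replicate_succ]
    rw [hw]
    exact ⟨_, rfl, u₁, by simp, _, rfl, _, rfl, _, rfl, _, rfl, List.replicate i a, by simp,
      _, rfl, _, rfl, _, rfl, u₂, by simp, _, rfl, _, rfl, _, rfl, _, rfl,
      List.replicate j a, by simp, _, rfl, _, rfl, _, rfl, u₃, by simp, _, rfl, _, rfl, rfl⟩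

section TwoBlocks

variable {a b : α} {x y z : Var}

theorem letters_twoBlocksWord (u₁ u₂ u₃ : List α) (i j : ℕ) :
    letters (twoBlocksWord a b x y z u₁ u₂ u₃ i j) =
      u₁ ++ (block a b i ++ (u₂ ++ (block a b j ++ u₃))) := by
  simp only [twoBlocksWord, letters, letters_append, letters_map_letter, List.append_nil]

theorem readAs_twoBlocksWord_z (hxz : x ≠ z) (hyz : y ≠ z) (u₁ u₂ u₃ : List α) (i j : ℕ) :
    ReadAs (twoBlocksWord a b x y z u₁ u₂ u₃ i j) z []
      (u₁.map .letter ++ .opening x :: ((block a b i).map .letter ++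
        .closing x :: (u₂.map .letter ++ .opening y :: ((block a b j).map .letter ++
          .closing y :: u₃.map .letter)))) [] := by
  refine ⟨by simp [twoBlocksWord], ?_, ?_, ?_⟩ <;> simp [Unread, hxz.symm, hyz.symm]

theorem readAs_twoBlocksWord_x (hxy : x ≠ y) (hxz : x ≠ z) (u₁ u₂ u₃ : List α) (i j : ℕ) :
    ReadAs (twoBlocksWord a b x y z u₁ u₂ u₃ i j) x (.opening z :: u₁.map .letter)
      ((block a b i).map .letter)
      (u₂.map .letter ++ .opening y :: ((block a b j).map .letter ++
          .closing y :: (u₃.map .letter ++ [.closing z]))) := by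
  refine ⟨by simp [twoBlocksWord], ?_, ?_, ?_⟩ <;> simp [Unread, hxz, hxy]

theorem readAs_twoBlocksWord_y (hxy : x ≠ y) (hyz : y ≠ z) (u₁ u₂ u₃ : List α) (i j : ℕ) :
    ReadAs (twoBlocksWord a b x y z u₁ u₂ u₃ i j) y
      (.opening z :: (u₁.map .letter ++ .opening x :: ((block a b i).map .letter ++
        .closing x :: u₂.map .letter)))
      ((block a b j).map .letter) (u₃.map .letter ++ [.closing z]) := by
  refine ⟨by simp [twoBlocksWord], ?_, ?_, ?_⟩ <;> simp [Unread, hyz, hxy.symm]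

theorem unread_twoBlocksWord {t : Var} (hx : t ≠ x) (hy : t ≠ y) (hz : t ≠ z)
    (u₁ u₂ u₃ : List α) (i j : ℕ) : Unread (twoBlocksWord a b x y z u₁ u₂ u₃ i j) t := by
  simp [Unread, twoBlocksWord, hx, hy, hz]

theorem validLabels_twoBlocksWord (hxy : x ≠ y) (hxz : x ≠ z) (hyz : y ≠ z) (u₁ u₂ u₃ : List α)
    (i j : ℕ) : ValidLabels (twoBlocksWord a b x y z u₁ u₂ u₃ i j) := by
  intro t
  by_cases hx : t = x
  · subst hx
    exact Or.inr ⟨_, _, _, readAs_twoBlocksWord_x hxy hxz ..⟩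
  by_cases hy : t = y
  · subst hy
    exact Or.inr ⟨_, _, _, readAs_twoBlocksWord_y hxy hyz ..⟩
  by_cases hz : t = z
  · subst hz
    exact Or.inr ⟨_, _, _, readAs_twoBlocksWord_z hxz hyz ..⟩
  exact Or.inl (unread_twoBlocksWord hx hy hz ..)

end TwoBlocks

theorem Spanner.isSchemaBased_of_dom_eq {P : Spanner α Var} {D : Set Var}
    (h : ∀ d, ∀ m ∈ P.toFun d, m.dom = D) : P.IsSchemaBased := by
  intro d m hm
  refine (Spanner.dom_subset_svars hm).antisymm ?_
  rintro x ⟨d', m', hm', hx⟩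
  rwa [h d m hm, ← h d' m' hm']

theorem Spanner.IsSchemaBasedCore.isCore {P : Spanner α Var} (h : P.IsSchemaBasedCore) :
    P.IsCore := by
  induction h with
  | regular h _ => exact .regular h
  | proj Y hY _ ih => exact .proj Y hY ih
  | union _ _ _ ih₁ ih₂ => exact .union ih₁ ih₂
  | join _ _ ih₁ ih₂ => exact .join ih₁ ih₂
  | eqSel Y _ _ ih => exact .eqSel Y ih

/-- The spanner that extracts two disjoint factors of the form `b aⁿ b` with `n ≥ 1`, and the whole
document. -/
noncomputable def twoBlocks (a b : α) (x y z : Var) : Spanner α Var :=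
  (patternVA (twoBlocksPattern a b x y z)).spanner

/-- The spanner that assigns the whole document to `z` if some factor `b aⁿ b` with `n ≥ 1` has two
disjoint occurrences. -/
noncomputable def repeatedBlock (a b : α) (x y z : Var) : Spanner α Var :=
  ((twoBlocks a b x y z).eqSel {x, y}).proj {z}

/-- The mapping that assigns only `z`, to the span `t`. -/
noncomputable def singleMapping (z : Var) (t : Span) : Mapping Var where
  toFun := by classical exact fun v => if v = z then some t else none
  finite_dom := (Set.finite_singleton z).subset (by
    rintro v ⟨s, hs⟩
    by_contra hv
    have : v ≠ z := hv
    simp [this] at hs)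

theorem singleMapping_self (z : Var) (t : Span) : (singleMapping z t).toFun z = some t := by
  simp [singleMapping]

theorem singleMapping_of_ne {z v : Var} (t : Span) (h : v ≠ z) :
    (singleMapping z t).toFun v = none := by
  simp [singleMapping, h]

theorem dom_singleMapping (z : Var) (t : Span) : (singleMapping z t).dom = {z} := by
  ext v
  by_cases h : v = z
  · subst h
    simp [Mapping.dom, singleMapping_self]
  · simp [Mapping.dom, singleMapping_of_ne t h, h]

theorem eq_of_singleMapping_eq_some {z v : Var} {s t : Span}
    (h : (singleMapping z t).toFun v = some s) : v = z ∧ s = t := by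
  by_cases hv : v = z
  · subst hv
    exact ⟨rfl, Option.some.inj (h.symm.trans (singleMapping_self v t))⟩
  · simp [singleMapping_of_ne t hv] at h

theorem exists_three_ne (β : Type*) [Infinite β] : ∃ x y z : β, x ≠ y ∧ x ≠ z ∧ y ≠ z := by
  let g := Infinite.natEmbedding β
  have hg : ∀ i j, i ≠ j → g i ≠ g j := fun i j h h' => h (g.injective h')
  exact ⟨g 0, g 1, g 2, hg 0 1 (by simp), hg 0 2 (by simp), hg 1 2 (by simp)⟩

section Spanners

variable {a b : α} {x y z : Var}

theorem mem_twoBlocks {d : List α} {m : Mapping Var} :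
    m ∈ (twoBlocks a b x y z).toFun d ↔ ∃ u₁ u₂ u₃ i j, 1 ≤ i ∧ 1 ≤ j ∧
      d = u₁ ++ (block a b i ++ (u₂ ++ (block a b j ++ u₃))) ∧
        Defines (twoBlocksWord a b x y z u₁ u₂ u₃ i j) m := by
  constructor
  · rintro ⟨w, hw, rfl, hm⟩
    obtain ⟨u₁, u₂, u₃, i, j, hi, hj, rfl⟩ :=
      matches_twoBlocksPattern.1 (patternVA_accepts.1 hw)
    exact ⟨u₁, u₂, u₃, i, j, hi, hj, letters_twoBlocksWord .., hm⟩
  · rintro ⟨u₁, u₂, u₃, i, j, hi, hj, rfl, hm⟩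
    exact ⟨_, patternVA_accepts.2 (matches_twoBlocksPattern.2 ⟨u₁, u₂, u₃, i, j, hi, hj, rfl⟩),
      letters_twoBlocksWord .., hm⟩

theorem content_append_append (u v t : List α) :
    content (u ++ (v ++ t)) ⟨u.length, u.length + v.length, Nat.le_add_right _ _⟩ = v := by
  simp [content]

theorem block_injective (a b : α) : Function.Injective (block a b) := by
  intro i j h
  simpa [length_block] using congrArg List.length h

/-- The spans that a mapping captured by `twoBlocks` assigns to `x` and `y` have equal contents
iff the two blocks are equal. -/
theorem content_eq_iff_of_defines (hxy : x ≠ y) (hxz : x ≠ z) (hyz : y ≠ z) {u₁ u₂ u₃ : List α}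
    {i j : ℕ} {m : Mapping Var} (hm : Defines (twoBlocksWord a b x y z u₁ u₂ u₃ i j) m) :
    (∀ v ∈ ({x, y} : Set Var), ∀ v' ∈ ({x, y} : Set Var), ∀ s t, m.toFun v = some s →
      m.toFun v' = some t →
        content (u₁ ++ (block a b i ++ (u₂ ++ (block a b j ++ u₃)))) s =
          content (u₁ ++ (block a b i ++ (u₂ ++ (block a b j ++ u₃)))) t) ↔ i = j := by
  classical
  have hx := hm.toFun_eq (readAs_twoBlocksWord_x hxy hxz ..)
  have hy := hm.toFun_eq (readAs_twoBlocksWord_y hxy hyz ..)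
  have cx := content_append_append u₁ (block a b i) (u₂ ++ (block a b j ++ u₃))
  have cy := content_append_append (u₁ ++ (block a b i ++ u₂)) (block a b j) u₃
  simp only [List.append_assoc] at cy
  simp only [letters, letters_append, letters_map_letter] at hx hy
  have key : ∀ v ∈ ({x, y} : Set Var), ∀ s, m.toFun v = some s →
      content (u₁ ++ (block a b i ++ (u₂ ++ (block a b j ++ u₃)))) s =
        block a b (if v = x then i else j) := by
    rintro v (rfl | rfl) s hs
    · obtain rfl := Option.some.inj (hx.symm.trans hs)
      simpa using cx
    · obtain rfl := Option.some.inj (hy.symm.trans hs)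
      simpa [hxy.symm] using cy
  constructor
  · intro h
    have := h x (by simp) y (by simp) _ _ hx hy
    rw [key x (by simp) _ hx, key y (by simp) _ hy] at this
    simpa [hxy.symm] using block_injective a b this
  · rintro rfl v hv v' hv' s t hs ht
    rw [key v hv s hs, key v' hv' t ht, ite_self, ite_self]

theorem mem_repeatedBlock (hxy : x ≠ y) (hxz : x ≠ z) (hyz : y ≠ z) {d : List α}
    {m : Mapping Var} :
    m ∈ (repeatedBlock a b x y z).toFun d ↔
      m = singleMapping z ⟨0, d.length, Nat.zero_le _⟩ ∧ ∃ u₁ u₂ u₃ i, 1 ≤ i ∧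
        d = u₁ ++ (block a b i ++ (u₂ ++ (block a b i ++ u₃))) := by
  have key : ∀ u₁ u₂ u₃ i j, ∀ m : Mapping Var,
      Defines (twoBlocksWord a b x y z u₁ u₂ u₃ i j) m →
      m.restrict {z} = singleMapping z
        ⟨0, (u₁ ++ (block a b i ++ (u₂ ++ (block a b j ++ u₃)))).length, Nat.zero_le _⟩ := by
    intro u₁ u₂ u₃ i j m hm
    have hz := hm.toFun_eq (readAs_twoBlocksWord_z hxz hyz ..)
    ext1
    funext v
    by_cases hv : v = z
    · subst hv
      simp [Mapping.restrict, singleMapping_self, hz, letters, letters_append,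
        letters_map_letter, -List.map_append]
    · rw [singleMapping_of_ne _ hv]
      simp [Mapping.restrict, hv]
  constructor
  · rintro ⟨m, ⟨hm, heq⟩, rfl⟩
    obtain ⟨u₁, u₂, u₃, i, j, hi, hj, rfl, hdef⟩ := mem_twoBlocks.1 hm
    obtain rfl := (content_eq_iff_of_defines hxy hxz hyz hdef).1 heq
    exact ⟨key _ _ _ _ _ _ hdef, u₁, u₂, u₃, i, hi, rfl⟩
  · rintro ⟨rfl, u₁, u₂, u₃, i, hi, rfl⟩
    obtain ⟨m, hm⟩ := (validLabels_twoBlocksWord (a := a) (b := b) hxy hxz hyz u₁ u₂ u₃ i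
      i).exists_defines
    exact ⟨m, ⟨mem_twoBlocks.2 ⟨u₁, u₂, u₃, i, i, hi, hi, rfl, hm⟩,
      (content_eq_iff_of_defines hxy hxz hyz hm).2 rfl⟩, key _ _ _ _ _ _ hm⟩

theorem exists_mem_repeatedBlock (a b : α) (hxy : x ≠ y) (hxz : x ≠ z) (hyz : y ≠ z) :
    ∃ d m, m ∈ (repeatedBlock a b x y z).toFun d :=
  ⟨_, _, (mem_repeatedBlock hxy hxz hyz).2 ⟨rfl, [], [], [], 1, le_rfl, rfl⟩⟩

theorem dom_of_mem_twoBlocks (hxy : x ≠ y) (hxz : x ≠ z) (hyz : y ≠ z) {d : List α}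
    {m : Mapping Var} (h : m ∈ (twoBlocks a b x y z).toFun d) : m.dom = {x, y, z} := by
  obtain ⟨u₁, u₂, u₃, i, j, -, -, -, hm⟩ := mem_twoBlocks.1 h
  ext v
  simp only [Mapping.dom, Set.mem_ofPred_eq, Set.mem_insert_iff, Set.mem_singleton_iff]
  constructor
  · rintro ⟨s, hs⟩
    by_contra! hv
    rw [hm.toFun_eq_none (unread_twoBlocksWord hv.1 hv.2.1 hv.2.2 ..)] at hs
    simp at hs
  · rintro (rfl | rfl | rfl)
    · exact ⟨_, hm.toFun_eq (readAs_twoBlocksWord_x hxy hxz ..)⟩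
    · exact ⟨_, hm.toFun_eq (readAs_twoBlocksWord_y hxy hyz ..)⟩
    · exact ⟨_, hm.toFun_eq (readAs_twoBlocksWord_z hxz hyz ..)⟩

theorem isSchemaBasedCore_repeatedBlock (a b : α) (hxy : x ≠ y) (hxz : x ≠ z) (hyz : y ≠ z) :
    (repeatedBlock a b x y z).IsSchemaBasedCore := by
  obtain ⟨d, _, m, hm, rfl⟩ := exists_mem_repeatedBlock a b hxy hxz hyz
  have hdom := dom_of_mem_twoBlocks hxy hxz hyz hm.1
  refine .proj _ ?_ (.eqSel _ ?_ (.regular ⟨_, ?_, rfl⟩ (Spanner.isSchemaBased_of_dom_eq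
    fun d m h => dom_of_mem_twoBlocks hxy hxz hyz h)))
  · rintro v rfl
    exact ⟨d, m, hm, by simp [hdom]⟩
  · rintro v hv
    exact ⟨d, m, hm.1, by rw [hdom]; rcases hv with rfl | rfl <;> simp⟩
  · intro w hw
    obtain ⟨u₁, u₂, u₃, i, j, -, -, rfl⟩ := matches_twoBlocksPattern.1 (patternVA_accepts.1 hw)
    exact validLabels_twoBlocksWord hxy hxz hyz _ _ _ _ _

/-! ### Skylines that are not pumpable -/

/-- On every document, the regular spanner of `z{} Σ*` captures one mapping: `z ↦ [0, 0⟩`. -/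
theorem mem_startSpanner {d : List α} {m : Mapping Var} :
    m ∈ (patternVA (startPattern α z)).spanner.toFun d ↔ m = singleMapping z ⟨0, 0, le_rfl⟩ := by
  have key : ∀ u : List α, Defines (.opening z :: .closing z :: u.map .letter)
      (singleMapping z ⟨0, 0, le_rfl⟩) := by
    intro u v
    by_cases hv : v = z
    · subst hv
      exact Or.inr ⟨[], [], u.map .letter, ⟨rfl, by simp [Unread], by simp [Unread],
        unread_map_letter u v⟩, singleMapping_self ..⟩
    · exact Or.inl ⟨by simp [Unread, hv], singleMapping_of_ne _ hv⟩
  constructor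
  · rintro ⟨w, hw, -, hm⟩
    obtain ⟨u, rfl⟩ := matches_startPattern.1 (patternVA_accepts.1 hw)
    exact hm.unique (key u)
  · rintro rfl
    exact ⟨_, patternVA_accepts.2 (matches_startPattern.2 ⟨d, rfl⟩), by simp [letters], key d⟩

theorem isSequential_startPattern : (patternVA (startPattern α z)).IsSequential := by
  intro w hw v
  obtain ⟨u, rfl⟩ := matches_startPattern.1 (patternVA_accepts.1 hw)
  by_cases hv : v = z
  · subst hv
    exact Or.inr ⟨[], [], u.map .letter, rfl, by simp [Unread], by simp [Unread],
      unread_map_letter u v⟩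
  · exact Or.inl (by simp [Unread, hv])

/-- The mapping that assigns no variable. -/
def emptyMapping (Var : Type*) : Mapping Var := ⟨fun _ => none, by simp⟩

/-- On every document, the regular spanner of `Σ*` captures the empty mapping and no other. -/
theorem mem_anySpanner {d : List α} {m : Mapping Var} :
    m ∈ (patternVA (anyPattern α Var)).spanner.toFun d ↔ m = emptyMapping Var := by
  have key : ∀ u : List α, Defines (u.map .letter) (emptyMapping Var) :=
    fun u v => Or.inl ⟨unread_map_letter u v, rfl⟩
  constructor
  · rintro ⟨w, hw, -, hm⟩
    obtain ⟨u, rfl⟩ := matches_anyPattern.1 (patternVA_accepts.1 hw)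
    exact hm.unique (key u)
  · rintro rfl
    exact ⟨_, patternVA_accepts.2 (matches_anyPattern.2 ⟨d, rfl⟩), by simp, key d⟩

theorem isSequential_anyPattern : (patternVA (anyPattern α Var)).IsSequential := by
  intro w hw v
  obtain ⟨u, rfl⟩ := matches_anyPattern.1 (patternVA_accepts.1 hw)
  exact Or.inl (unread_map_letter u v)

/-- No block is repeated in a document made of distinct blocks. -/
theorem not_mem_repeatedBlock_doc (hab : a ≠ b) (hxy : x ≠ y) (hxz : x ≠ z) (hyz : y ≠ z)
    {ns : List ℕ} (hns : ns.Nodup) (m : Mapping Var) :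
    m ∉ (repeatedBlock a b x y z).toFun (doc a b ns) := by
  intro hm
  obtain ⟨-, u₁, u₂, u₃, i, hi, hd⟩ := (mem_repeatedBlock hxy hxz hyz).1 hm
  obtain ⟨ms, ls, rfl, h₁⟩ := exists_of_doc_eq hab hi hd
  obtain ⟨ms', ls', e, h₂⟩ := exists_of_doc_eq hab hi
    (u := u₁ ++ (block a b i ++ u₂)) (v := u₃) (hd.trans (by simp))
  have h3 := List.nodup_middle.1 hns
  rw [List.nodup_cons, List.mem_append, not_or] at h3
  have := ((List.append_cons_inj_of_notMem h3.1.1 h3.1.2).1 e).1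
  subst this
  have := congrArg List.length (h₂.trans h₁.symm)
  simp [length_block] at this

/-- Let `P₀` capture exactly the mapping `m₀` on every document, where `m₀` assigns at most the
empty span `[0, 0⟩`. If a domination rule lets the mapping of `repeatedBlock` dominate `m₀`, then
the skyline of the union of `P₀` and `repeatedBlock` captures `m₀` on documents without repeated blocks,
but not on those in which two adjacent blocks are equal. So it is not pumpable. -/
theorem not_isCore_skyline_union (hab : a ≠ b) (hxy : x ≠ y) (hxz : x ≠ z) (hyz : y ≠ z)
    (D : DominationRule α Var) {P₀ : Spanner α Var} {m₀ : Mapping Var}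
    (hP₀ : ∀ d m, m ∈ P₀.toFun d ↔ m = m₀) (hm₀ : ∀ v t, m₀.toFun v = some t → t.hi = 0)
    (hD : ∀ d : List α, D.rel d m₀ (singleMapping z ⟨0, d.length, Nat.zero_le _⟩)) :
    ¬ (skyline D (P₀.union (repeatedBlock a b x y z))).IsCore := by
  intro hcore
  obtain ⟨-, N, p, k, hp, h⟩ := hcore.pumpable hab
  let f : ℕ → ℕ := fun i => N + p * i + 1
  have hf : Function.Injective f := by
    intro i j hij
    simp only [f] at hij
    exact Nat.eq_of_mul_eq_mul_left hp (by omega)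
  have hnd : ((List.range (k + 2)).map f).Nodup := List.nodup_range.map hf
  have hm : m₀ ∈ (skyline D (P₀.union (repeatedBlock a b x y z))).toFun
      (doc a b ((List.range (k + 2)).map f)) := by
    refine ⟨Or.inl ((hP₀ _ _).2 rfl), ?_⟩
    rintro m ⟨hm | hm, hne⟩
    · exact absurd ((hP₀ _ _).1 hm) hne
    · exact absurd hm (not_mem_repeatedBlock_doc hab hxy hxz hyz hnd m)
  obtain ⟨B, hB, h⟩ := h _ hnd m₀ hm
  obtain ⟨i, hi, hiB⟩ : ∃ i ∈ Finset.range (k + 1), i ∉ B :=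
    Finset.exists_mem_notMem_of_card_lt_card (by rw [Finset.card_range]; omega)
  rw [Finset.mem_range] at hi
  obtain ⟨r, hr⟩ := Nat.exists_eq_add_of_le (show i + 2 ≤ k + 2 by omega)
  -- pumping the block with index `i` by the period makes it equal to the next one
  have hsplit : (List.range (k + 2)).map f = (List.range i).map f ++ f i :: (f (i + 1) ::
      (List.range r).map fun j => f (i + 2 + j)) := by
    rw [hr, List.range_add, List.range_succ, List.range_succ]
    simp
  have hpump := h _ _ _ hsplit (by simpa using hiB) (by simp only [f]; omega) p dvd_rfl
  have hnext : f i + p = f (i + 1) := by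
    simp only [f]
    ring
  have hshift : ∀ s, m₀.shift s p = m₀ := by
    intro s
    ext1
    funext v
    simp only [Mapping.shift]
    cases hv : m₀.toFun v with
    | none => rfl
    | some t =>
      have h1 := hm₀ v t hv
      have h2 := t.le
      simp only [Option.map_some, Option.some.injEq]
      ext
      · exact shiftPos_of_le _ (by omega)
      · exact shiftPos_of_le _ (by omega)
  rw [hshift, hnext] at hpump
  -- the two equal adjacent blocks make `repeatedBlock` capture a mapping that dominates `m₀`
  refine hpump.2 _ ⟨Or.inr ((mem_repeatedBlock hxy hxz hyz).2 ⟨rfl,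
    doc a b ((List.range i).map f), [], doc a b ((List.range r).map fun j => f (i + 2 + j)),
    f (i + 1), by simp [f], by simp⟩), ?_⟩ (hD _)
  intro he
  -- `m₀` does not assign a nonempty span
  have := hm₀ z _ (by rw [← Set.mem_singleton_iff.1 he]; exact singleMapping_self ..)
  simp [length_block] at this

end Spanners

/-- A failure of closure under `η_spanInc`: `P` captures `z ↦ [0, 0⟩`, and also `z ↦ [0, |d|⟩` if a
block is repeated. -/
theorem exists_isSchemaBasedCore_not_isCore_skyline_spanInc (α Var : Type*) [Nontrivial α]
    [Infinite Var] : ∃ P : Spanner α Var, P.IsSchemaBasedCore ∧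
      ¬ (skyline (spanInc α Var) P).IsCore := by
  obtain ⟨a, b, hab⟩ := exists_pair_ne α
  obtain ⟨x, y, z, hxy, hxz, hyz⟩ := exists_three_ne Var
  have hd₁ : ∀ d, ∀ m ∈ (repeatedBlock a b x y z).toFun d, m.dom = {z} := by
    intro d m hm
    rw [((mem_repeatedBlock hxy hxz hyz).1 hm).1, dom_singleMapping]
  have hd₀ : ∀ d, ∀ m ∈ (patternVA (startPattern α z)).spanner.toFun d, m.dom = {z} := by
    intro d m hm
    rw [mem_startSpanner.1 hm, dom_singleMapping]
  refine ⟨(patternVA (startPattern α z)).spanner.union (repeatedBlock a b x y z),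
    .union ?_ (.regular ⟨_, isSequential_startPattern, rfl⟩
      (Spanner.isSchemaBased_of_dom_eq hd₀)) (isSchemaBasedCore_repeatedBlock a b hxy hxz hyz),
    not_isCore_skyline_union hab hxy hxz hyz _ (fun d m => mem_startSpanner) ?_ ?_⟩
  · obtain ⟨d, m, hm⟩ := exists_mem_repeatedBlock a b hxy hxz hyz
    have hm₀ := (mem_startSpanner (z := z) (d := d)).2 rfl
    rw [← Spanner.isSchemaBased_of_dom_eq hd₁ d m hm, hd₁ d m hm,
      ← Spanner.isSchemaBased_of_dom_eq hd₀ d _ hm₀, hd₀ d _ hm₀]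
  · intro v t ht
    rw [(eq_of_singleMapping_eq_some ht).2]
  · intro d
    refine ⟨by rw [dom_singleMapping, dom_singleMapping], fun v s t hs ht => ?_⟩
    rw [(eq_of_singleMapping_eq_some hs).2, (eq_of_singleMapping_eq_some ht).2]
    exact ⟨le_rfl, Nat.zero_le _⟩

/-- A failure of closure under `η_varInc`: `P` captures the empty mapping, and also `z ↦ [0, |d|⟩`
if a block is repeated. -/
theorem exists_isCore_not_isCore_skyline_varInc (α Var : Type*) [Nontrivial α] [Infinite Var] :
    ∃ P : Spanner α Var, P.IsCore ∧ ¬ (skyline (varInc α Var) P).IsCore := by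
  obtain ⟨a, b, hab⟩ := exists_pair_ne α
  obtain ⟨x, y, z, hxy, hxz, hyz⟩ := exists_three_ne Var
  refine ⟨(patternVA (anyPattern α Var)).spanner.union (repeatedBlock a b x y z),
    .union (.regular ⟨_, isSequential_anyPattern, rfl⟩)
      (isSchemaBasedCore_repeatedBlock a b hxy hxz hyz).isCore,
    not_isCore_skyline_union hab hxy hxz hyz _ (fun d m => mem_anySpanner) ?_ ?_⟩
  · intro v t ht
    simp [emptyMapping] at ht
  · intro d v t ht
    simp [emptyMapping] at ht

end DocSpanner

theorem theorem4p4 {α : Type*} [Finite α] [Nontrivial α] {Var : Type*} [Infinite Var] :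
    (∃ P : DocSpanner.Spanner α Var, P.IsSchemaBasedCore ∧
      ¬ (DocSpanner.skyline (DocSpanner.spanInc α Var) P).IsCore) ∧
    (∃ P : DocSpanner.Spanner α Var, P.IsCore ∧
      ¬ (DocSpanner.skyline (DocSpanner.varInc α Var) P).IsCore) :=
  ⟨DocSpanner.exists_isSchemaBasedCore_not_isCore_skyline_spanInc α Var,
    DocSpanner.exists_isCore_not_isCore_skyline_varInc α Var⟩
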